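/- Let $n\ge 1$, let $J=\mathrm{diag}(1,-1,\dots,-1)$ be of size $n+1$, and let $(x,y)_{-1}=x\cdot Jy$ be the Lorentzian product on $\mathbb R^{n+1}$. Put $(x\otimes x)_{-1}=x\,(Jx)^{T}$ and $(x\wedge y)_{-1}=x\,(Jy)^{T}-y\,(Jx)^{T}$. Let $SO(1,n)=\{g:\det g=1,\ gJg^T=J\}$ with Lie algebra $so(1,n)$, let $\mathrm{Sym}_{-1}$ be the space of trace-zero matrices $P$ with $(Px,y)_{-1}=(x,Py)_{-1}$, on which $SO(1,n)$ acts by conjugation, and let $G_s=\mathrm{Sym}_{-1}\rtimes SO(1,n)$, with Lie algebra $\mathfrak g_s=\mathrm{Sym}_{-1}\rtimes so(1,n)$, bracket $[\,,]_s$. The form $\langle A,B\rangle=-\tfrac12\mathrm{Tr}(AB)$ identifies $\mathfrak g_s^*$ with $\mathrm{Sym}_{-1}\oplus so(1,n)=sl_{n+1}(\mathbb R)$. On a coadjoint orbit, a tangent vector $V_i$ at $L$ is defined by $M_i\in\mathfrak g_s$ through $\langle V_i,U\rangle=\langle L,[M_i,U]_s\rangle$ for all $U\in\mathfrak g_s$,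 and the symplectic form is $\omega_L(V_1,V_2)=\langle L,[M_2,M_1]_s\rangle$. Let $x_0\in\mathbb R^{n+1}$ with $r=(x_0,x_0)_{-1}\neq 0$, and let $\mathcal S$ be the coadjoint orbit of $G_s$ through $P_0=(x_0\otimes x_0)_{-1}-\frac{r}{n+1}I$. 1. $\mathcal S=\{(x\otimes x)_{-1}-\frac{r}{n+1}I+(x\wedge y)_{-1}:\ x,y\in\mathbb R^{n+1},\ (x,x)_{-1}=r\}$. 2. Let $T=\{(x,y):(x,x)_{-1}=r,\ (x,y)_{-1}=0\}$. The map $y\mapsto (y,\cdot)_{-1}$ is, for each $x$ with $(x,x)_{-1}=r$, a bijection from $\{y:(x,y)_{-1}=0\}$ onto the dual of the tangent space $\{v:(x,v)_{-1}=0\}$, so $T$ is the cotangent bundle of the quadric $\{(x,x)_{-1}=r\}$. Its canonical symplectic form $-d\theta$, with $\theta_{(x,y)}(\dot x,\dot y)=(y,\dot x)_{-1}$, is $$\omega_{(x,y)}((\dot x_1,\dot y_1),(\dot x_2,\dot y_2))=(\dot x_1,\dot y_2)_{-1}-(\dot x_2,\dot y_1)_{-1}.$$ 3. The map $\Phi(x,y)=(x\otimes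 x)_{-1}-\frac{(x,x)_{-1}}{n+1}I+(x\wedge y)_{-1}$ sends $T$ onto $\mathcal S$, its fibres on $T$ are the pairs $\{(x,y),(-x,-y)\}$, its differential at each point of $T$ maps the tangent space of $T$ bijectively onto that of $\mathcal S$, and it pulls the symplectic form of $\mathcal S$ back to the canonical form. 4. If $r>0$, then $\Phi$ restricts to a symplectomorphism from the cotangent bundle $\{(x,y)\in T: x^{(0)}>0\}$ of the hyperboloid $\mathbb H^n=\{x:(x,x)_{-1}=r,\ x^{(0)}>0\}$ (where $x^{(0)}$ is the first coordinate of $x$), with its canonical form, onto $\mathcal S$. For the opposite sign convention $\omega_L(V_1,V_2)=\langle L,[M_1,M_2]_s\rangle$, the map $(x,y)\mapsto\Phi(x,-y)$ is such a symplectomorphism. -/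

import Mathlib

open Matrix Set
open scoped Matrix.Norms.Operator ContDiff

namespace HyperbolicOrbit

/-! ### The Lorentzian form and the symmetric pair `(SL(n+1), SO(1,n))` -/

/-- The space `ℝ^{n+1}`; the coordinate with index `0` is the time coordinate. -/
abbrev Vec (n : ℕ) : Type := Fin (n + 1) → ℝ

/-- Real `(n+1) × (n+1)` matrices (any norm may be used on them: only differentiability and
smoothness are expressed through it). -/
abbrev Mat (n : ℕ) : Type := Matrix (Fin (n + 1)) (Fin (n + 1)) ℝ

/-- `J = diag(1, -1, …, -1)`. -/
def J (n : ℕ) : Mat n := Matrix.diagonal (Fin.cons 1 fun _ => -1)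

/-- The Lorentzian product `(x, y)₋₁ = x · J y = x₀ y₀ - ∑_{i ≥ 1} xᵢ yᵢ`. -/
noncomputable def lor (n : ℕ) : LinearMap.BilinForm ℝ (Vec n) := Matrix.toBilin' (J n)

theorem lor_apply (n : ℕ) (x y : Vec n) : lor n x y = x ⬝ᵥ (J n *ᵥ y) :=
  Matrix.toBilin'_apply' _ _ _

theorem lor_eq (n : ℕ) (x y : Vec n) :
    lor n x y = x 0 * y 0 - ∑ i : Fin n, x i.succ * y i.succ := by
  rw [lor_apply]
  simp [J, dotProduct, Matrix.mulVec_diagonal, Fin.sum_univ_succ, sub_eq_add_neg]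

/-- `Sym₋₁`: trace-zero matrices that are symmetric for the Lorentzian product. -/
def symm (n : ℕ) : Submodule ℝ (Mat n) :=
  selfAdjointMatricesSubmodule (J n) ⊓ LinearMap.ker (Matrix.traceLinearMap (Fin (n + 1)) ℝ ℝ)

theorem mem_symm {n : ℕ} {P : Mat n} : P ∈ symm n ↔ Pᵀ * J n = J n * P ∧ P.trace = 0 := by
  simp [symm, Matrix.IsSelfAdjoint, Matrix.IsAdjointPair]

/-- `so(1,n)`: matrices that are skew-symmetric for the Lorentzian product. -/
def so (n : ℕ) : Submodule ℝ (Mat n) := skewAdjointMatricesSubmodule (J n)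

theorem mem_so {n : ℕ} {A : Mat n} : A ∈ so n ↔ Aᵀ * J n = J n * -A := by
  simp [so, Matrix.IsSkewAdjoint, Matrix.IsAdjointPair]

theorem J_mul_J (n : ℕ) : J n * J n = 1 := by
  rw [J, Matrix.diagonal_mul_diagonal, ← Matrix.diagonal_one]
  congr 1
  funext i
  refine Fin.cases ?_ (fun j => ?_) i <;> simp

theorem J_transpose (n : ℕ) : (J n)ᵀ = J n := by simp [J]

/-- `SO(1,n)`: matrices `g` with `det g = 1` and `g J gᵀ = J`. -/
def SO1 (n : ℕ) : Subgroup (Matrix.SpecialLinearGroup (Fin (n + 1)) ℝ) where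
  carrier := {g | (g : Mat n) * J n * (g : Mat n)ᵀ = J n}
  one_mem' := by simp
  mul_mem' := by
    intro a b ha hb
    simp only [Set.mem_ofPred_eq] at *
    rw [Matrix.SpecialLinearGroup.coe_mul, Matrix.transpose_mul]
    calc (a : Mat n) * b * J n * ((b : Mat n)ᵀ * (a : Mat n)ᵀ)
        = a * (b * J n * (b : Mat n)ᵀ) * (a : Mat n)ᵀ := by simp only [mul_assoc]
      _ = J n := by rw [hb, ha]
  inv_mem' := by
    intro a ha
    simp only [Set.mem_ofPred_eq] at *
    have h1 : ((a⁻¹ : Matrix.SpecialLinearGroup _ ℝ) : Mat n) * a = 1 := by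
      rw [← Matrix.SpecialLinearGroup.coe_mul]; simp
    have h2 : (a : Mat n)ᵀ * ((a⁻¹ : Matrix.SpecialLinearGroup _ ℝ) : Mat n)ᵀ = 1 := by
      rw [← Matrix.transpose_mul, h1, Matrix.transpose_one]
    generalize ((a⁻¹ : Matrix.SpecialLinearGroup _ ℝ) : Mat n) = b at *
    calc b * J n * bᵀ = b * ((a : Mat n) * J n * (a : Mat n)ᵀ) * bᵀ := by rw [ha]
      _ = (b * a) * J n * ((a : Mat n)ᵀ * bᵀ) := by simp only [mul_assoc]
      _ = J n := by rw [h1, h2, one_mul, mul_one]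

/-- The matrix of an element of `SO(1,n)`. -/
def toMat {n : ℕ} (h : SO1 n) : Mat n := (h : Matrix.SpecialLinearGroup (Fin (n + 1)) ℝ)

@[simp] theorem toMat_one {n : ℕ} : toMat (1 : SO1 n) = 1 := by simp [toMat]

@[simp] theorem toMat_mul {n : ℕ} (g h : SO1 n) : toMat (g * h) = toMat g * toMat h := by
  simp [toMat]

theorem toMat_inv_mul {n : ℕ} (h : SO1 n) : toMat h⁻¹ * toMat h = 1 := by
  rw [← toMat_mul, inv_mul_cancel, toMat_one]

theorem toMat_mul_inv {n : ℕ} (h : SO1 n) : toMat h * toMat h⁻¹ = 1 := by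
  rw [← toMat_mul, mul_inv_cancel, toMat_one]

theorem toMat_mem {n : ℕ} (h : SO1 n) : toMat h * J n * (toMat h)ᵀ = J n := h.2

theorem toMat_inv {n : ℕ} (h : SO1 n) : toMat h⁻¹ = J n * (toMat h)ᵀ * J n := by
  have h1 : toMat h * (J n * (toMat h)ᵀ * J n) = 1 := by
    rw [← mul_assoc, ← mul_assoc, toMat_mem, J_mul_J]
  calc toMat h⁻¹ = toMat h⁻¹ * (toMat h * (J n * (toMat h)ᵀ * J n)) := by rw [h1, mul_one]
    _ = _ := by rw [← mul_assoc, toMat_inv_mul, one_mul]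

theorem transpose_mul_J {n : ℕ} (h : SO1 n) : (toMat h)ᵀ * J n = J n * toMat h⁻¹ := by
  rw [toMat_inv, ← mul_assoc, ← mul_assoc, J_mul_J, one_mul]

theorem conj_mem_symm {n : ℕ} (h : SO1 n) {P : Mat n} (hP : P ∈ symm n) :
    toMat h * P * toMat h⁻¹ ∈ symm n := by
  rw [mem_symm] at *
  refine ⟨?_, ?_⟩
  · have e := transpose_mul_J h⁻¹
    rw [inv_inv] at e
    rw [Matrix.transpose_mul, Matrix.transpose_mul]
    calc (toMat h⁻¹)ᵀ * (Pᵀ * (toMat h)ᵀ) * J n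
        = (toMat h⁻¹)ᵀ * (Pᵀ * ((toMat h)ᵀ * J n)) := by simp only [mul_assoc]
      _ = (toMat h⁻¹)ᵀ * (Pᵀ * J n) * toMat h⁻¹ := by rw [transpose_mul_J]; simp only [mul_assoc]
      _ = ((toMat h⁻¹)ᵀ * J n) * P * toMat h⁻¹ := by rw [hP.1]; simp only [mul_assoc]
      _ = _ := by rw [e]; simp only [mul_assoc]
  · rw [Matrix.trace_mul_comm, ← mul_assoc, toMat_inv_mul, one_mul, hP.2]

theorem conj_mem_so {n : ℕ} (h : SO1 n) {A : Mat n} (hA : A ∈ so n) :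
    toMat h * A * toMat h⁻¹ ∈ so n := by
  rw [mem_so] at *
  have e := transpose_mul_J h⁻¹
  rw [inv_inv] at e
  rw [Matrix.transpose_mul, Matrix.transpose_mul]
  calc (toMat h⁻¹)ᵀ * (Aᵀ * (toMat h)ᵀ) * J n
      = (toMat h⁻¹)ᵀ * (Aᵀ * ((toMat h)ᵀ * J n)) := by simp only [mul_assoc]
    _ = (toMat h⁻¹)ᵀ * (Aᵀ * J n) * toMat h⁻¹ := by rw [transpose_mul_J]; simp only [mul_assoc]
    _ = ((toMat h⁻¹)ᵀ * J n) * -A * toMat h⁻¹ := by rw [hA]; simp only [mul_assoc]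
    _ = _ := by rw [e]; simp only [mul_assoc, mul_neg, neg_mul]

theorem comm_mem_symm {n : ℕ} {B A : Mat n} (hB : B ∈ so n) (hA : A ∈ symm n) :
    B * A - A * B ∈ symm n := by
  rw [mem_symm] at *
  rw [mem_so] at hB
  refine ⟨?_, by rw [Matrix.trace_sub, Matrix.trace_mul_comm, sub_self]⟩
  rw [Matrix.transpose_sub, Matrix.transpose_mul, Matrix.transpose_mul, sub_mul, mul_assoc, hB,
    mul_assoc, hA.1, ← mul_assoc, hA.1, ← mul_assoc, hB]
  noncomm_ring

theorem comm_mem_so {n : ℕ} {B A : Mat n} (hB : B ∈ so n) (hA : A ∈ so n) :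
    B * A - A * B ∈ so n := by
  rw [mem_so] at *
  rw [Matrix.transpose_sub, Matrix.transpose_mul, Matrix.transpose_mul, sub_mul, mul_assoc, hB,
    mul_assoc, hA, ← mul_assoc, hA, ← mul_assoc, hB]
  noncomm_ring

/-! ### The semidirect product group `G_s = Sym₋₁ ⋊ SO(1,n)` -/

/-- The linear action `h · P = h P h⁻¹` of `SO(1,n)` on `Sym₋₁`. -/
def conjSymm {n : ℕ} (h : SO1 n) : symm n ≃+ symm n where
  toFun P := ⟨toMat h * P * toMat h⁻¹, conj_mem_symm h P.2⟩
  invFun P := ⟨toMat h⁻¹ * P * toMat h, by simpa using conj_mem_symm h⁻¹ P.2⟩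
  left_inv P := by
    ext1
    change toMat h⁻¹ * (toMat h * (P : Mat n) * toMat h⁻¹) * toMat h = P
    calc _ = (toMat h⁻¹ * toMat h) * (P : Mat n) * (toMat h⁻¹ * toMat h) := by
          simp only [mul_assoc]
      _ = P := by rw [toMat_inv_mul, one_mul, mul_one]
  right_inv P := by
    ext1
    change toMat h * (toMat h⁻¹ * (P : Mat n) * toMat h) * toMat h⁻¹ = P
    calc _ = (toMat h * toMat h⁻¹) * (P : Mat n) * (toMat h * toMat h⁻¹) := by
          simp only [mul_assoc]
      _ = P := by rw [toMat_mul_inv, one_mul, mul_one]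
  map_add' P Q := by
    ext1
    simp [mul_add, add_mul]

/-- The action of `SO(1,n)` on the additive group `Sym₋₁`, written multiplicatively. -/
def action (n : ℕ) : SO1 n →* MulAut (Multiplicative (symm n)) where
  toFun h := AddEquiv.toMultiplicative (conjSymm h)
  map_one' := by
    ext P : 1
    apply Multiplicative.toAdd.injective
    ext1
    simp [conjSymm]
  map_mul' g h := by
    ext P : 1
    apply Multiplicative.toAdd.injective
    ext1
    simp [conjSymm, mul_assoc]

/-- The group `G_s = Sym₋₁ ⋊ SO(1,n)`, with product `(X,g)(Y,h) = (X + g Y g⁻¹, g h)`. -/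
abbrev Gs (n : ℕ) : Type := Multiplicative (symm n) ⋊[action n] (SO1 n)

/-- The `Sym₋₁`-component of an element of `G_s`, as a matrix. -/
def Gs.vec {n : ℕ} (g : Gs n) : Mat n := (Multiplicative.toAdd g.left : symm n)

/-- The `SO(1,n)`-component of an element of `G_s`, as a matrix. -/
def Gs.rot {n : ℕ} (g : Gs n) : Mat n := toMat g.right

theorem Gs.vec_mem {n : ℕ} (g : Gs n) : g.vec ∈ symm n := (Multiplicative.toAdd g.left).2

theorem Gs.vec_mul {n : ℕ} (g h : Gs n) :
    (g * h).vec = g.vec + g.rot * h.vec * toMat g.right⁻¹ := rfl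

theorem Gs.rot_mul {n : ℕ} (g h : Gs n) : (g * h).rot = g.rot * h.rot := toMat_mul _ _

theorem Gs.vec_inv {n : ℕ} (g : Gs n) :
    (g⁻¹).vec = -(toMat g.right⁻¹ * g.vec * g.rot) := by
  change toMat g.right⁻¹ * (-g.vec) * toMat (g.right⁻¹)⁻¹ = _
  rw [inv_inv, mul_neg, neg_mul, Gs.rot]

/-! ### Its Lie algebra `g_s = Sym₋₁ ⋊ so(1,n)` -/

/-- The Lie algebra of `G_s`: pairs `(A, B)` with `A ∈ Sym₋₁` and `B ∈ so(1,n)`. -/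
def LieGs (n : ℕ) : Type := symm n × so n

namespace LieGs

variable {n : ℕ}

instance : AddCommGroup (LieGs n) := inferInstanceAs (AddCommGroup (symm n × so n))

noncomputable instance : Module ℝ (LieGs n) := inferInstanceAs (Module ℝ (symm n × so n))

/-- The `Sym₋₁`-component, as a matrix. -/
def p (Z : LieGs n) : Mat n := Z.1

/-- The `so(1,n)`-component, as a matrix. -/
def k (Z : LieGs n) : Mat n := Z.2

theorem p_mem (Z : LieGs n) : Z.p ∈ symm n := Z.1.2

theorem k_mem (Z : LieGs n) : Z.k ∈ so n := Z.2.2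

/-- The element of the Lie algebra with given components. -/
def mk (A B : Mat n) (hA : A ∈ symm n) (hB : B ∈ so n) : LieGs n := (⟨A, hA⟩, ⟨B, hB⟩)

@[simp] theorem p_mk (A B : Mat n) (hA hB) : (mk A B hA hB).p = A := rfl
@[simp] theorem k_mk (A B : Mat n) (hA hB) : (mk A B hA hB).k = B := rfl
@[simp] theorem p_add (Z W : LieGs n) : (Z + W).p = Z.p + W.p := rfl
@[simp] theorem k_add (Z W : LieGs n) : (Z + W).k = Z.k + W.k := rfl
@[simp] theorem p_smul (c : ℝ) (Z : LieGs n) : (c • Z).p = c • Z.p := rfl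
@[simp] theorem k_smul (c : ℝ) (Z : LieGs n) : (c • Z).k = c • Z.k := rfl
@[simp] theorem p_zero : (0 : LieGs n).p = 0 := rfl
@[simp] theorem k_zero : (0 : LieGs n).k = 0 := rfl

@[ext] theorem ext' {Z W : LieGs n} (hp : Z.p = W.p) (hk : Z.k = W.k) : Z = W :=
  Prod.ext (Subtype.ext hp) (Subtype.ext hk)

/-- The semidirect bracket `[(A₁,B₁),(A₂,B₂)]_s = ([B₁,A₂] - [B₂,A₁], [B₁,B₂])`. -/
instance : Bracket (LieGs n) (LieGs n) where
  bracket Z W := mk ((Z.k * W.p - W.p * Z.k) - (W.k * Z.p - Z.p * W.k)) (Z.k * W.k - W.k * Z.k)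
    ((symm n).sub_mem (comm_mem_symm Z.k_mem W.p_mem) (comm_mem_symm W.k_mem Z.p_mem))
    (comm_mem_so Z.k_mem W.k_mem)

@[simp] theorem p_lie (Z W : LieGs n) :
    ⁅Z, W⁆.p = (Z.k * W.p - W.p * Z.k) - (W.k * Z.p - Z.p * W.k) := rfl

@[simp] theorem k_lie (Z W : LieGs n) : ⁅Z, W⁆.k = Z.k * W.k - W.k * Z.k := rfl

instance : LieRing (LieGs n) where
  add_lie x y z := by ext1 <;> simp <;> noncomm_ring
  lie_add x y z := by ext1 <;> simp <;> noncomm_ring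
  lie_self x := by ext1 <;> simp
  leibniz_lie x y z := by ext1 <;> simp <;> noncomm_ring

noncomputable instance : LieAlgebra ℝ (LieGs n) where
  lie_smul t x y := by ext1 <;> simp [smul_sub]

end LieGs

/-! ### Adjoint and coadjoint action, coadjoint orbits and their symplectic form -/

/-- `(U, V) ↦ (h U h⁻¹ + [X, h V h⁻¹], h V h⁻¹)`, for `g = (X,h) ∈ G_s`. -/
def adFun {n : ℕ} (g : Gs n) (Z : LieGs n) : LieGs n :=
  LieGs.mk
    (toMat g.right * Z.p * toMat g.right⁻¹ -
      (toMat g.right * Z.k * toMat g.right⁻¹ * g.vec -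
        g.vec * (toMat g.right * Z.k * toMat g.right⁻¹)))
    (toMat g.right * Z.k * toMat g.right⁻¹)
    ((symm n).sub_mem (conj_mem_symm g.right Z.p_mem)
      (comm_mem_symm (conj_mem_so g.right Z.k_mem) g.vec_mem))
    (conj_mem_so g.right Z.k_mem)

theorem adFun_p {n : ℕ} (g : Gs n) (Z : LieGs n) : (adFun g Z).p =
    g.rot * Z.p * toMat g.right⁻¹ -
      (g.rot * Z.k * toMat g.right⁻¹ * g.vec - g.vec * (g.rot * Z.k * toMat g.right⁻¹)) := rfl

theorem adFun_k {n : ℕ} (g : Gs n) (Z : LieGs n) :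
    (adFun g Z).k = g.rot * Z.k * toMat g.right⁻¹ := rfl

/-- The adjoint action of `g = (X,h) ∈ G_s`:
`Ad_g (U,V) = (h U h⁻¹ + [X, h V h⁻¹], h V h⁻¹)`, the differential at the identity of
conjugation by `g` (see `hasDerivAt_conj`). -/
noncomputable def Ad {n : ℕ} (g : Gs n) : LieGs n →ₗ[ℝ] LieGs n where
  toFun := adFun g
  map_add' Z W := by
    ext1
    · simp only [LieGs.p_add, LieGs.k_add, adFun_p]
      noncomm_ring
    · simp only [LieGs.k_add, adFun_k]
      noncomm_ring
  map_smul' c Z := by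
    ext1 <;> simp [adFun_p, adFun_k, smul_sub]

theorem Ad_p {n : ℕ} (g : Gs n) (Z : LieGs n) : (Ad g Z).p =
    g.rot * Z.p * toMat g.right⁻¹ -
      (g.rot * Z.k * toMat g.right⁻¹ * g.vec - g.vec * (g.rot * Z.k * toMat g.right⁻¹)) := rfl

theorem Ad_k {n : ℕ} (g : Gs n) (Z : LieGs n) :
    (Ad g Z).k = g.rot * Z.k * toMat g.right⁻¹ := rfl

/-- `Ad g` is the differential of `a ↦ g a g⁻¹` at the identity: if a curve `c` in `G_s` passes
through `1` with velocity `Z`, then `g c(t) g⁻¹` has velocity `Ad g Z`. -/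
theorem hasDerivAt_conj {n : ℕ} (g : Gs n) (c : ℝ → Gs n) (Z : LieGs n) (h0 : c 0 = 1)
    (hp : HasDerivAt (fun t => (c t).vec) Z.p 0) (hk : HasDerivAt (fun t => (c t).rot) Z.k 0) :
    HasDerivAt (fun t => (g * c t * g⁻¹).vec) (Ad g Z).p 0 ∧
      HasDerivAt (fun t => (g * c t * g⁻¹).rot) (Ad g Z).k 0 := by
  have hv0 : (c 0).vec = 0 := by rw [h0]; rfl
  have hr0 : (c 0).rot = 1 := by rw [h0]; exact toMat_one
  have e2 : ∀ t, (g * c t * g⁻¹).rot = g.rot * (c t).rot * toMat g.right⁻¹ := fun t => by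
    rw [Gs.rot_mul, Gs.rot_mul]; rfl
  have hR : HasDerivAt (fun t => g.rot * (c t).rot * toMat g.right⁻¹) (Ad g Z).k 0 :=
    (hk.const_mul g.rot).mul_const _
  refine ⟨?_, by simpa only [e2] using hR⟩
  have hinv : HasDerivAt (fun t => toMat (c t).right⁻¹) (-Z.k) 0 := by
    have h1 : HasDerivAt (fun t => ((c t).rot)ᵀ) (Z.k)ᵀ 0 := by
      let T : Mat n →L[ℝ] Mat n :=
        LinearMap.toContinuousLinearMap (Matrix.transposeLinearEquiv _ _ ℝ ℝ).toLinearMap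
      exact T.hasFDerivAt.comp_hasDerivAt 0 hk
    have h2 := (h1.const_mul (J n)).mul_const (J n)
    have h3 : J n * (Z.k)ᵀ * J n = -Z.k := by
      rw [mul_assoc, mem_so.1 Z.k_mem, ← mul_assoc, J_mul_J, one_mul]
    rw [h3] at h2
    have e4 : ∀ t, toMat (c t).right⁻¹ = J n * ((c t).rot)ᵀ * J n := fun t => toMat_inv _
    rw [funext e4]
    exact h2
  have e1 : ∀ t, (g * c t * g⁻¹).vec = g.vec + g.rot * (c t).vec * toMat g.right⁻¹ -
      g.rot * (c t).rot * toMat g.right⁻¹ * g.vec *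
        (g.rot * toMat (c t).right⁻¹ * toMat g.right⁻¹) := fun t => by
    have e5 : toMat (g * c t).right⁻¹ = toMat (c t).right⁻¹ * toMat g.right⁻¹ := by
      rw [← toMat_mul, ← _root_.mul_inv_rev]; rfl
    rw [Gs.vec_mul, Gs.vec_mul, Gs.rot_mul, Gs.vec_inv, e5]
    noncomm_ring
  have hI : HasDerivAt (fun t => g.rot * toMat (c t).right⁻¹ * toMat g.right⁻¹)
      (g.rot * (-Z.k) * toMat g.right⁻¹) 0 := (hinv.const_mul _).mul_const _
  have hV : HasDerivAt (fun t => g.vec + g.rot * (c t).vec * toMat g.right⁻¹)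
      (g.rot * Z.p * toMat g.right⁻¹) 0 := ((hp.const_mul _).mul_const _).const_add _
  have key := hV.sub ((hR.mul_const g.vec).mul hI)
  have hr1 : g.rot * toMat g.right⁻¹ = 1 := toMat_mul_inv _
  have hc1 : toMat (c 0).right⁻¹ = 1 := by rw [h0, SemidirectProduct.one_right, inv_one, toMat_one]
  rw [hr0, hc1, mul_one, hr1, one_mul, mul_one] at key
  have e3 : (Ad g Z).p = g.rot * Z.p * toMat g.right⁻¹ -
      ((Ad g Z).k * g.vec + g.vec * (g.rot * (-Z.k) * toMat g.right⁻¹)) := by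
    rw [Ad_p, Ad_k]; noncomm_ring
  rw [e3, funext e1]
  exact key

/-- The coadjoint orbit `{l₀ ∘ Ad_{g⁻¹} : g ∈ G_s}` in the dual of the Lie algebra. -/
def coadjointOrbit {n : ℕ} (l₀ : Module.Dual ℝ (LieGs n)) : Set (Module.Dual ℝ (LieGs n)) :=
  {l | ∃ g : Gs n, l = l₀ ∘ₗ Ad g⁻¹}

/-- `ad* M (l) = l ∘ ad M`. The vectors `ad* M (l)`, `M ∈ g_s`, form the tangent space of the
coadjoint orbit at `l`. -/
noncomputable def coad {n : ℕ} (M : LieGs n) (l : Module.Dual ℝ (LieGs n)) :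
    Module.Dual ℝ (LieGs n) :=
  l ∘ₗ (LieAlgebra.ad ℝ (LieGs n) M : LieGs n →ₗ[ℝ] LieGs n)

theorem coad_apply {n : ℕ} (M Z : LieGs n) (l : Module.Dual ℝ (LieGs n)) :
    coad M l Z = l ⁅M, Z⁆ := rfl

open Classical in
/-- The symplectic form of coadjoint orbits:
`ω_l(v₁, v₂) = l([M₁, M₂])` for `v₁ = ad* M₁ (l)` and `v₂ = ad* M₂ (l)`
(see `coadForm_coad`; the value for other arguments is irrelevant). -/
noncomputable def coadForm {n : ℕ} (l v₁ v₂ : Module.Dual ℝ (LieGs n)) : ℝ :=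
  if h : (∃ M, v₁ = coad M l) ∧ (∃ M, v₂ = coad M l) then l ⁅h.1.choose, h.2.choose⁆ else 0

theorem coadForm_coad {n : ℕ} (l : Module.Dual ℝ (LieGs n)) (M₁ M₂ : LieGs n) :
    coadForm l (coad M₁ l) (coad M₂ l) = l ⁅M₁, M₂⁆ := by
  have h : (∃ M, coad M₁ l = coad M l) ∧ (∃ M, coad M₂ l = coad M l) := ⟨⟨_, rfl⟩, ⟨_, rfl⟩⟩
  rw [coadForm, dif_pos h]
  have e1 := LinearMap.congr_fun h.1.choose_spec h.2.choose
  have e2 := LinearMap.congr_fun h.2.choose_spec M₁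
  simp only [coad_apply] at e1 e2
  rw [← e1, ← lie_skew, map_neg, ← e2, ← map_neg, lie_skew]

/-! ### Identification of the dual with trace-zero matrices -/

/-- The functional `(A, B) ↦ ⟨L, A + B⟩` attached to a matrix `L`, where
`⟨X, Y⟩ = -½ tr(X Y)`. On matrices of trace zero this is the identification of
`sl(n+1) = Sym₋₁ ⊕ so(1,n)` with the dual of `g_s`. -/
noncomputable def toDual {n : ℕ} (L : Mat n) : Module.Dual ℝ (LieGs n) where
  toFun Z := -(1 / 2) * (L * (Z.p + Z.k)).trace
  map_add' Z W := by simp [mul_add]; ring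
  map_smul' c Z := by simp [← smul_add]; ring

/-- The coadjoint orbit through (the functional of) `P`, as a set of trace-zero matrices. -/
def orbit {n : ℕ} (P : Mat n) : Set (Mat n) :=
  {L | L.trace = 0 ∧ toDual L ∈ coadjointOrbit (toDual P)}

/-- The tangent space at `L` of the coadjoint orbit through `L`, as a set of trace-zero matrices:
all `V` with `⟨V, U⟩ = ⟨L, [M, U]⟩` for all `U`, for some `M ∈ g_s`. -/
def orbitTangent {n : ℕ} (L : Mat n) : Set (Mat n) :=
  {V | V.trace = 0 ∧ ∃ M : LieGs n, toDual V = coad M (toDual L)}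

/-- The symplectic form of the orbit, on matrices: `ω_L(V₁, V₂) = ⟨L, [M₁, M₂]⟩` where
`Vᵢ` is the tangent vector defined by `Mᵢ`. -/
noncomputable def orbitForm {n : ℕ} (L V₁ V₂ : Mat n) : ℝ :=
  coadForm (toDual L) (toDual V₁) (toDual V₂)

/-! ### Rank one and rank two hyperbolic matrices -/

/-- `(x ⊗ x)₋₁ = x ⊗ J x`. -/
noncomputable def tensor {n : ℕ} (x : Vec n) : Mat n := Matrix.vecMulVec x (J n *ᵥ x)

/-- `(x ∧ y)₋₁ = x ⊗ J y - y ⊗ J x`. -/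
noncomputable def wedge {n : ℕ} (x y : Vec n) : Mat n :=
  Matrix.vecMulVec x (J n *ᵥ y) - Matrix.vecMulVec y (J n *ᵥ x)

/-- The trace-zero part `(x ⊗ x)₋₁ - (x, x)₋₁ / (n + 1) I` of `(x ⊗ x)₋₁`. -/
noncomputable def rankOne {n : ℕ} (x : Vec n) : Mat n :=
  tensor x - (lor n x x / ((n : ℝ) + 1)) • (1 : Mat n)

/-- `(x, y) ↦ (x ⊗ x)₋₁ - (x, x)₋₁ / (n + 1) I + (x ∧ y)₋₁`. -/
noncomputable def orbitMap {n : ℕ} (q : Vec n × Vec n) : Mat n := rankOne q.1 + wedge q.1 q.2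

/-! ### The cotangent bundle of the quadric and its canonical form -/

/-- The (co)tangent bundle of the quadric `{x : (x,x)₋₁ = r}`, `r ≠ 0`: pairs `(x, y)` with
`(x,x)₋₁ = r` and `(x,y)₋₁ = 0`. The vector `y` stands for the covector `(y, ·)₋₁` on the tangent
space `{v : (x,v)₋₁ = 0}`. -/
def quadricBundle (n : ℕ) (r : ℝ) : Set (Vec n × Vec n) :=
  {q | lor n q.1 q.1 = r ∧ lor n q.1 q.2 = 0}

/-- The (co)tangent bundle of the hyperboloid `{x : (x,x)₋₁ = r, x₀ > 0}`, `r > 0`. -/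
def hyperboloidBundle (n : ℕ) (r : ℝ) : Set (Vec n × Vec n) :=
  {q | q ∈ quadricBundle n r ∧ 0 < q.1 0}

/-- The tangent space of `quadricBundle n r` at `(x,y)`: the vectors `(ẋ,ẏ)` with `(x,ẋ)₋₁ = 0` and
`(ẋ,y)₋₁ + (x,ẏ)₋₁ = 0`. -/
def bundleTangent {n : ℕ} (q : Vec n × Vec n) : Set (Vec n × Vec n) :=
  {v | lor n q.1 v.1 = 0 ∧ lor n v.1 q.2 + lor n q.1 v.2 = 0}

/-- The covector `(y, ·)₋₁` on the tangent space `{v : (x,v)₋₁ = 0}` of the quadric at `x`. -/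
noncomputable def covector {n : ℕ} (x y : Vec n) :
    Module.Dual ℝ (LinearMap.ker (lor n x)) :=
  (lor n y).domRestrict (LinearMap.ker (lor n x))

/-- The tautological one-form `θ` of the cotangent bundle: at the covector `(y, ·)₋₁` based at `x`
its value on `(ẋ, ẏ)` is `(y, ẋ)₋₁`. -/
noncomputable def tautForm {n : ℕ} (q v : Vec n × Vec n) : ℝ := lor n q.2 v.1

/-- The canonical symplectic form `-dθ` of the cotangent bundle, where
`dθ(v, w) = ∂_v (θ(w)) - ∂_w (θ(v))` for constant vector fields `v`, `w`. -/
noncomputable def canonicalForm {n : ℕ} (q v w : Vec n × Vec n) : ℝ :=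
  -(fderiv ℝ (fun q' : Vec n × Vec n => tautForm q' w) q v -
    fderiv ℝ (fun q' : Vec n × Vec n => tautForm q' v) q w)

/-! ### Symplectomorphisms between embedded submanifolds of vector spaces -/

/-- `f` restricts to a diffeomorphism from `M` onto `N` that carries the form `σ` to the form `τ`.
Here `M` and `N` are submanifolds of the vector spaces `E` and `F`, with tangent spaces `TM x` and
`TN y` and with two-forms `σ` and `τ` on these; smoothness of `f` and of its inverse means that they
are restrictions of smooth maps of open neighbourhoods. -/
structure IsSymplectomorphism {E F : Type*} [NormedAddCommGroup E] [NormedSpace ℝ E]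
    [NormedAddCommGroup F] [NormedSpace ℝ F]
    (M : Set E) (TM : E → Set E) (σ : E → E → E → ℝ)
    (N : Set F) (TN : F → Set F) (τ : F → F → F → ℝ) (f : E → F) : Prop where
  bijOn : BijOn f M N
  smooth : ∃ U : Set E, IsOpen U ∧ M ⊆ U ∧ ContDiffOn ℝ ∞ f U
  smooth_inv : ∃ (W : Set F) (g : F → E), IsOpen W ∧ N ⊆ W ∧ ContDiffOn ℝ ∞ g W ∧
    ∀ x ∈ M, g (f x) = x
  bijOn_tangent : ∀ x ∈ M, BijOn (fderiv ℝ f x) (TM x) (TN (f x))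
  form_eq : ∀ x ∈ M, ∀ v ∈ TM x, ∀ w ∈ TM x,
    τ (f x) (fderiv ℝ f x v) (fderiv ℝ f x w) = σ x v w

end HyperbolicOrbit

open HyperbolicOrbit

namespace HyperbolicOrbit

/-! ### The Lorentzian form -/

/-! With respect to the adjoint `M ↦ J Mᵀ J`, trace-zero matrices split into the self-adjoint part
`Sym₋₁` and the skew part `so(1,n)`. These are orthogonal for the trace (`trace_symm_mul_so`), and
commutators respect the splitting. Hence the coadjoint action can be written on matrices: an element
with translation part `X` and rotation part `h` takes `P ∈ Sym₋₁` to `h⁻¹ (P + [P, X]) h`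
(`toDual_comp_Ad`). For the rank-one `P` attached to `x`, the commutator `[P, X]` is `x ∧ Xx`
(`rankOne_comm_symm`). So rotations move `x`, while translations add a bivector `x ∧ y`.

The orbit is the full image of the bundle because `SO(1,n)` is transitive on each non-null quadric,
by products of two reflections (`exists_toMat_mulVec_eq`), and because `Xx` can be any vector
orthogonal to `x` (`exists_symm_mulVec`). Conversely, replacing `y` by its component orthogonal to
`x` does not change `x ∧ y`. The self-adjoint part of a point of the orbit determines `x` up to
sign; the skew part applied to `x` is `-r y`, so it then determines `y` (`orbitMap_eq_iff`).

Infinitesimally, `M = (A, B)` defines at the image of `(x, y)` the derivative of `orbitMap` along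
`(-Bx, Ax - By)` (`coad_toDual_orbitMap`), and every tangent vector of the bundle has this form
(`exists_lieGs_of_mem_bundleTangent`). The orbit form is therefore a trace pairing of one tangent
vector with the Lie algebra element of the other, which evaluates to the canonical form
(`orbitForm_fderiv_orbitMap`).

For `r > 0` the sign of the time coordinate selects one point in each fibre, and the first column of
`x ⊗ Jx` gives a smooth inverse. Negating the fibre coordinate handles the opposite sign convention.
-/

theorem lor_comm {n : ℕ} (x y : Vec n) : lor n x y = lor n y x := by
  simp only [lor_eq, mul_comm]

theorem eq_zero_of_lor {n : ℕ} {x : Vec n} (h : ∀ y, lor n x y = 0) : x = 0 := by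
  -- Pairing with `J x` turns the Lorentzian product into the Euclidean norm squared.
  have h1 := h (J n *ᵥ x)
  rw [lor_apply, mulVec_mulVec, J_mul_J, one_mulVec] at h1
  exact dotProduct_self_eq_zero.1 h1

theorem J_mulVec_zero {n : ℕ} (x : Vec n) : (J n *ᵥ x) 0 = x 0 := by
  simp [J, mulVec_diagonal]

/-! ### The matrices `x ⊗ J y` -/

/-- The bilinear map `(x, y) ↦ x ⊗ J y`, the matrix of `z ↦ (y, z)₋₁ x`. -/
noncomputable def dyad {n : ℕ} : Vec n →ₗ[ℝ] Vec n →ₗ[ℝ] Mat n :=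
  LinearMap.mk₂ ℝ (fun x y => vecMulVec x (J n *ᵥ y))
    (fun _ _ _ => add_vecMulVec _ _ _) (fun _ _ _ => smul_vecMulVec _ _ _)
    (fun _ _ _ => by rw [mulVec_add, vecMulVec_add])
    (fun _ _ _ => by rw [mulVec_smul, vecMulVec_smul])

theorem dyad_apply {n : ℕ} (x y : Vec n) : dyad x y = vecMulVec x (J n *ᵥ y) := rfl

theorem tensor_eq {n : ℕ} (x : Vec n) : tensor x = dyad x x := rfl

theorem wedge_eq {n : ℕ} (x y : Vec n) : wedge x y = dyad x y - dyad y x := rfl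

theorem dyad_mulVec {n : ℕ} (x y z : Vec n) : dyad x y *ᵥ z = lor n y z • x := by
  rw [dyad_apply, vecMulVec_mulVec, op_smul_eq_smul, dotProduct_comm, ← lor_apply, lor_comm]

theorem mul_dyad {n : ℕ} (M : Mat n) (x y : Vec n) : M * dyad x y = dyad (M *ᵥ x) y :=
  mul_vecMulVec _ _ _

theorem trace_dyad {n : ℕ} (x y : Vec n) : (dyad x y).trace = lor n x y := by
  rw [dyad_apply, trace_vecMulVec, lor_apply]

/-- The hypothesis says that `N` is the Lorentzian adjoint of `M`. It is used with `N` equal to `M`,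
`-M` and `M⁻¹`, for `Sym₋₁`, `so(1,n)` and `SO(1,n)` respectively. -/
theorem dyad_mul_of_transpose {n : ℕ} {M N : Mat n} (h : Mᵀ * J n = J n * N) (x y : Vec n) :
    dyad x y * M = dyad x (N *ᵥ y) := by
  rw [dyad_apply, vecMulVec_mul, ← mulVec_transpose, mulVec_mulVec, h, ← mulVec_mulVec, dyad_apply]

theorem dyad_mul_symm {n : ℕ} {A : Mat n} (hA : A ∈ symm n) (x y : Vec n) :
    dyad x y * A = dyad x (A *ᵥ y) :=
  dyad_mul_of_transpose (mem_symm.1 hA).1 x y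

theorem dyad_mul_so {n : ℕ} {B : Mat n} (hB : B ∈ so n) (x y : Vec n) :
    dyad x y * B = -dyad x (B *ᵥ y) := by
  rw [dyad_mul_of_transpose (mem_so.1 hB), neg_mulVec, map_neg]

theorem dyad_mul_toMat {n : ℕ} (h : SO1 n) (x y : Vec n) :
    dyad x y * toMat h = dyad x (toMat h⁻¹ *ᵥ y) :=
  dyad_mul_of_transpose (transpose_mul_J h) x y

theorem J_mul_dyad_transpose_mul_J {n : ℕ} (x y : Vec n) :
    J n * (dyad x y)ᵀ * J n = dyad y x := by
  rw [dyad_apply, transpose_vecMulVec, mul_vecMulVec, mulVec_mulVec, J_mul_J, one_mulVec,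
    vecMulVec_mul, ← mulVec_transpose, J_transpose, dyad_apply]

theorem trace_dyad_mul {n : ℕ} (x y : Vec n) (M : Mat n) :
    (dyad x y * M).trace = lor n (M *ᵥ x) y := by
  rw [trace_mul_comm, mul_dyad, trace_dyad]

theorem dyad_transpose_mul_J {n : ℕ} (x y : Vec n) : (dyad x y)ᵀ * J n = J n * dyad y x := by
  rw [← J_mul_dyad_transpose_mul_J x y, ← mul_assoc, ← mul_assoc, J_mul_J, one_mul]

theorem lor_symm_mulVec {n : ℕ} {A : Mat n} (hA : A ∈ symm n) (x y : Vec n) :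
    lor n (A *ᵥ x) y = lor n x (A *ᵥ y) := by
  rw [← trace_dyad, ← mul_dyad, trace_mul_comm, dyad_mul_symm hA, trace_dyad]

theorem lor_so_mulVec {n : ℕ} {B : Mat n} (hB : B ∈ so n) (x y : Vec n) :
    lor n (B *ᵥ x) y = -lor n x (B *ᵥ y) := by
  rw [← trace_dyad, ← mul_dyad, trace_mul_comm, dyad_mul_so hB, trace_neg, trace_dyad]

theorem lor_so_mulVec_self {n : ℕ} {B : Mat n} (hB : B ∈ so n) (x : Vec n) :
    lor n x (B *ᵥ x) = 0 := by
  have := lor_so_mulVec hB x x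
  rw [lor_comm] at this
  linarith

theorem lor_toMat_mulVec {n : ℕ} (h : SO1 n) (x y : Vec n) :
    lor n (toMat h *ᵥ x) (toMat h *ᵥ y) = lor n x y := by
  rw [← trace_dyad, ← mul_dyad, trace_mul_comm, dyad_mul_toMat, mulVec_mulVec, toMat_inv_mul,
    one_mulVec, trace_dyad]

theorem wedge_mem_so {n : ℕ} (x y : Vec n) : wedge x y ∈ so n := by
  rw [mem_so, wedge_eq, transpose_sub, sub_mul, dyad_transpose_mul_J, dyad_transpose_mul_J]
  noncomm_ring

theorem dyad_add_dyad_mem_symm {n : ℕ} {x y : Vec n} (h : lor n x y = 0) :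
    dyad x y + dyad y x ∈ symm n := by
  rw [mem_symm, transpose_add, add_mul, dyad_transpose_mul_J, dyad_transpose_mul_J, trace_add,
    trace_dyad, trace_dyad, lor_comm y x, h, mul_add]
  exact ⟨add_comm _ _, add_zero _⟩

theorem rankOne_mem_symm {n : ℕ} (x : Vec n) : rankOne x ∈ symm n := by
  rw [mem_symm, rankOne, tensor_eq]
  refine ⟨?_, ?_⟩
  · rw [transpose_sub, sub_mul, dyad_transpose_mul_J, transpose_smul, transpose_one]
    simp [mul_sub]
  · rw [trace_sub, trace_dyad, trace_smul, trace_one, Fintype.card_fin, smul_eq_mul]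
    have : (n : ℝ) + 1 ≠ 0 := by positivity
    push_cast
    field_simp
    ring

theorem rankOne_mulVec {n : ℕ} (x z : Vec n) :
    rankOne x *ᵥ z = lor n x z • x - (lor n x x / ((n : ℝ) + 1)) • z := by
  rw [rankOne, tensor_eq, sub_mulVec, dyad_mulVec, smul_mulVec, one_mulVec]

theorem wedge_mulVec {n : ℕ} (x y z : Vec n) :
    wedge x y *ᵥ z = lor n y z • x - lor n x z • y := by
  rw [wedge_eq, sub_mulVec, dyad_mulVec, dyad_mulVec]

theorem wedge_smul_self {n : ℕ} (x : Vec n) (c : ℝ) : wedge x (c • x) = 0 := by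
  simp [wedge_eq]

theorem wedge_add_right {n : ℕ} (x y z : Vec n) : wedge x (y + z) = wedge x y + wedge x z := by
  simp only [wedge_eq, map_add, LinearMap.add_apply]
  abel

theorem trace_wedge_mul_so {n : ℕ} {B : Mat n} (hB : B ∈ so n) (x y : Vec n) :
    (wedge x y * B).trace = 2 * lor n y (B *ᵥ x) := by
  rw [wedge_eq, sub_mul, trace_sub, trace_dyad_mul, trace_dyad_mul, lor_so_mulVec hB y x,
    lor_comm _ y]
  ring

/-! ### Trace pairings -/

/-- Passing to the adjoint preserves the trace, reverses the product and changes the sign of the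
skew factor only. -/
theorem trace_symm_mul_so {n : ℕ} {A B : Mat n} (hA : A ∈ symm n) (hB : B ∈ so n) :
    (A * B).trace = 0 := by
  have h : (A * B).trace = -(A * B).trace := by
    conv_lhs => rw [← trace_transpose, transpose_mul, ← mul_one Aᵀ, ← J_mul_J n, ← mul_assoc Aᵀ,
      (mem_symm.1 hA).1, ← mul_assoc, ← mul_assoc, (mem_so.1 hB)]
    rw [trace_mul_comm, ← mul_assoc, ← mul_assoc, J_mul_J, one_mul, neg_mul, trace_neg,
      trace_mul_comm]
  linarith

theorem trace_so_mul_symm {n : ℕ} {A B : Mat n} (hA : A ∈ symm n) (hB : B ∈ so n) :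
    (B * A).trace = 0 := by
  rw [trace_mul_comm, trace_symm_mul_so hA hB]

theorem comm_symm_mem_so {n : ℕ} {A A' : Mat n} (hA : A ∈ symm n) (hA' : A' ∈ symm n) :
    A * A' - A' * A ∈ so n := by
  rw [mem_symm] at *
  rw [mem_so, transpose_sub, transpose_mul, transpose_mul, sub_mul, mul_assoc, hA.1, mul_assoc,
    hA'.1, ← mul_assoc, ← mul_assoc, hA'.1, hA.1]
  noncomm_ring

theorem comm_symm_so_mem {n : ℕ} {A B : Mat n} (hA : A ∈ symm n) (hB : B ∈ so n) :
    A * B - B * A ∈ symm n := by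
  rw [← neg_sub]
  exact (symm n).neg_mem (comm_mem_symm hB hA)

theorem trace_eq_zero_of_mem_so {n : ℕ} {B : Mat n} (hB : B ∈ so n) : B.trace = 0 := by
  have h : B.trace = -B.trace := by
    conv_lhs => rw [← trace_transpose, ← mul_one Bᵀ, ← J_mul_J n, ← mul_assoc, mem_so.1 hB,
      trace_mul_comm, ← mul_assoc, J_mul_J, one_mul, trace_neg]
  linarith

theorem trace_mul_comm_sub {n : ℕ} (A B C : Mat n) :
    (A * (B * C - C * B)).trace = ((A * B - B * A) * C).trace := by
  rw [mul_sub, sub_mul, trace_sub, trace_sub, ← mul_assoc, ← mul_assoc, mul_assoc B A C,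
    trace_mul_comm B]

theorem toDual_apply {n : ℕ} (L : Mat n) (Z : LieGs n) :
    toDual L Z = -(1 / 2) * (L * (Z.p + Z.k)).trace := rfl

theorem exists_p_add_k {n : ℕ} {U : Mat n} (hU : U.trace = 0) : ∃ Z : LieGs n, Z.p + Z.k = U := by
  have hJ : (J n * Uᵀ * J n)ᵀ * J n = J n * U := by
    rw [transpose_mul, transpose_mul, J_transpose, transpose_transpose, mul_assoc, mul_assoc,
      J_mul_J, mul_one]
  have hU' : Uᵀ * J n = J n * (J n * Uᵀ * J n) := by
    rw [← mul_assoc, ← mul_assoc, J_mul_J, one_mul]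
  -- The components are the self-adjoint and skew halves of `U`; the vanishing trace is needed only
  -- for the first to lie in `Sym₋₁`.
  refine ⟨LieGs.mk ((1 / 2 : ℝ) • (U + J n * Uᵀ * J n)) ((1 / 2 : ℝ) • (U - J n * Uᵀ * J n))
    (Submodule.smul_mem _ _ (mem_symm.2 ⟨?_, ?_⟩)) (Submodule.smul_mem _ _ (mem_so.2 ?_)), ?_⟩
  · rw [transpose_add, add_mul, hJ, hU', mul_add, add_comm (J n * U)]
  · rw [trace_add, hU, trace_mul_comm, ← mul_assoc, J_mul_J, one_mul, trace_transpose, hU, add_zero]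
  · rw [transpose_sub, sub_mul, hJ, hU', neg_sub, mul_sub]
  · rw [LieGs.p_mk, LieGs.k_mk]
    module

theorem toDual_sub {n : ℕ} (L L' : Mat n) : toDual (L - L') = toDual L - toDual L' := by
  ext Z
  simp only [toDual_apply, LinearMap.sub_apply, sub_mul, trace_sub]
  ring

theorem eq_of_toDual_eq {n : ℕ} {L L' : Mat n} (hL : L.trace = 0) (hL' : L'.trace = 0)
    (h : toDual L = toDual L') : L = L' := by
  have hd : (L - L').trace = 0 := by rw [trace_sub, hL, hL', sub_zero]
  -- Testing against the transpose of the difference makes the trace pairing its Frobenius norm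
  -- squared, up to a factor.
  obtain ⟨Z, hZ⟩ := exists_p_add_k (U := (L - L')ᵀ) (by rw [trace_transpose, hd])
  have h1 : toDual (L - L') Z = 0 := by rw [toDual_sub, h, sub_self, LinearMap.zero_apply]
  rw [toDual_apply, hZ] at h1
  have h2 : ((L - L') * (L - L')ᴴ).trace = 0 := by
    rw [conjTranspose_eq_transpose_of_trivial]
    linarith
  exact sub_eq_zero.1 (trace_mul_conjTranspose_self_eq_zero_iff.1 h2)

/-- The tangent vector of the orbit at `P + W` defined by `M`. -/
theorem coad_toDual {n : ℕ} {P W : Mat n} (hP : P ∈ symm n) (hW : W ∈ so n) (M : LieGs n) :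
    coad M (toDual (P + W)) =
      toDual ((P * M.k - M.k * P) + (P * M.p - M.p * P) + (W * M.k - M.k * W)) := by
  ext Z
  -- The terms `e1` to `e6` pair a self-adjoint matrix with a skew one and vanish; `f1` to `f3` move
  -- the commutator with `M` from `Z` onto `P` and `W`.
  have e1 := trace_symm_mul_so hP (comm_mem_so M.k_mem Z.k_mem)
  have e2 := trace_so_mul_symm (comm_mem_symm M.k_mem Z.p_mem) hW
  have e3 := trace_so_mul_symm (comm_symm_so_mem M.p_mem Z.k_mem) hW
  have e4 := trace_symm_mul_so (comm_symm_so_mem hP M.k_mem) Z.k_mem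
  have e5 := trace_so_mul_symm Z.p_mem (comm_symm_mem_so hP M.p_mem)
  have e6 := trace_so_mul_symm Z.p_mem (comm_mem_so hW M.k_mem)
  have f1 := trace_mul_comm_sub P M.k Z.p
  have f2 := trace_mul_comm_sub P M.p Z.k
  have f3 := trace_mul_comm_sub W M.k Z.k
  rw [coad_apply, toDual_apply, toDual_apply, LieGs.p_lie, LieGs.k_lie,
    ← neg_sub (M.p * Z.k) (Z.k * M.p), sub_neg_eq_add]
  simp only [add_mul, mul_add, trace_add]
  rw [e1, e2, e3, e4, e5, e6, f1, f2, f3]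
  ring

/-- Cyclicity of the trace moves the conjugation and the commutator with `g.vec` onto `P`;
orthogonality of the two summands removes the cross terms. -/
theorem toDual_comp_Ad {n : ℕ} {P : Mat n} (hP : P ∈ symm n) (g : Gs n) :
    toDual P ∘ₗ Ad g =
      toDual (toMat g.right⁻¹ * (P + (P * g.vec - g.vec * P)) * toMat g.right) := by
  ext Z
  have e1 : (P * (toMat g.right * Z.k * toMat g.right⁻¹)).trace = 0 :=
    trace_symm_mul_so hP (conj_mem_so g.right Z.k_mem)
  have e2 : (toMat g.right⁻¹ * P * toMat g.right * Z.k).trace = 0 := by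
    have h := conj_mem_symm g.right⁻¹ hP
    rw [inv_inv] at h
    exact trace_symm_mul_so h Z.k_mem
  have e3 : (toMat g.right⁻¹ * (P * g.vec - g.vec * P) * toMat g.right * Z.p).trace = 0 := by
    have h := conj_mem_so g.right⁻¹ (comm_symm_mem_so hP g.vec_mem)
    rw [inv_inv] at h
    exact trace_so_mul_symm Z.p_mem h
  have f1 := trace_mul_comm_sub P g.vec (toMat g.right * Z.k * toMat g.right⁻¹)
  have c : ∀ X Y : Mat n, (X * (toMat g.right * Y * toMat g.right⁻¹)).trace =
      (toMat g.right⁻¹ * X * toMat g.right * Y).trace := fun X Y => by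
    rw [← mul_assoc, trace_mul_comm, ← mul_assoc, ← mul_assoc]
  rw [LinearMap.comp_apply, toDual_apply, toDual_apply, Ad_p, Ad_k, Gs.rot,
    ← neg_sub (g.vec * _) (_ * g.vec), sub_neg_eq_add]
  simp only [add_mul, mul_add, trace_add]
  rw [e1, f1, e2, e3, c, c]
  ring

/-! ### Transitivity of `SO(1,n)` on the quadrics -/

/-- The reflection in the hyperplane orthogonal to `v`. -/
noncomputable def refl {n : ℕ} (v : Vec n) : Mat n := 1 - (2 / lor n v v) • dyad v v

theorem refl_mulVec {n : ℕ} (v z : Vec n) :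
    refl v *ᵥ z = z - (2 / lor n v v * lor n v z) • v := by
  rw [refl, sub_mulVec, one_mulVec, smul_mulVec, dyad_mulVec, smul_smul]

theorem refl_mul_refl {n : ℕ} {v : Vec n} (hv : lor n v v ≠ 0) : refl v * refl v = 1 := by
  have h : dyad v v * dyad v v = lor n v v • dyad v v := by
    rw [mul_dyad, dyad_mulVec, map_smul, LinearMap.smul_apply]
  rw [refl, mul_sub, mul_one, sub_mul, one_mul, smul_mul_smul_comm, h, smul_smul]
  have e : 2 / lor n v v * (2 / lor n v v) * lor n v v = 2 * (2 / lor n v v) := by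
    field_simp
  rw [e]
  module

theorem refl_mem {n : ℕ} {v : Vec n} (hv : lor n v v ≠ 0) : refl v * J n * (refl v)ᵀ = J n := by
  have h : J n * (refl v)ᵀ * J n = refl v := by
    rw [refl, transpose_sub, transpose_one, transpose_smul, mul_sub, sub_mul, mul_one, J_mul_J,
      mul_smul_comm, smul_mul_assoc, J_mul_dyad_transpose_mul_J]
  calc refl v * J n * (refl v)ᵀ = refl v * (J n * (refl v)ᵀ * J n) * J n := by
        simp only [mul_assoc, J_mul_J, mul_one]
    _ = J n := by rw [h, refl_mul_refl hv, one_mul]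

/-- The matrix determinant lemma gives `1 - 2`. -/
theorem det_refl {n : ℕ} {v : Vec n} (hv : lor n v v ≠ 0) : (refl v).det = -1 := by
  have h : refl v =
      1 + replicateCol Unit v * replicateRow Unit (-(2 / lor n v v) • (J n *ᵥ v)) := by
    rw [← vecMulVec_eq, vecMulVec_smul, refl, dyad_apply, neg_smul, sub_eq_add_neg]
  rw [h, det_one_add_replicateCol_mul_replicateRow, smul_dotProduct, dotProduct_comm, ← lor_apply,
    smul_eq_mul]
  field_simp
  norm_num

theorem exists_SO1_of_refl {n : ℕ} {u v : Vec n} (hu : lor n u u ≠ 0) (hv : lor n v v ≠ 0) :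
    ∃ h : SO1 n, toMat h = refl u * refl v := by
  refine ⟨⟨⟨refl u * refl v, by rw [det_mul, det_refl hu, det_refl hv]; norm_num⟩, ?_⟩, rfl⟩
  change refl u * refl v * J n * (refl u * refl v)ᵀ = J n
  rw [transpose_mul]
  calc refl u * refl v * J n * ((refl v)ᵀ * (refl u)ᵀ)
      = refl u * (refl v * J n * (refl v)ᵀ) * (refl u)ᵀ := by simp only [mul_assoc]
    _ = J n := by rw [refl_mem hv, refl_mem hu]

theorem lor_single {n : ℕ} (x : Vec n) (i : Fin (n + 1)) :
    lor n x (Pi.single i 1) = J n i i * x i := by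
  rw [lor_comm, lor_apply, single_one_dotProduct]
  simp [J, mulVec_diagonal]

theorem J_apply_self_mul_self {n : ℕ} (i : Fin (n + 1)) : J n i i * J n i i = 1 := by
  refine Fin.cases ?_ (fun j => ?_) i <;> simp [J]

/-- For `n ≥ 1` the orthogonal complement of a non-null vector contains a non-null vector. -/
theorem exists_lor_eq_zero_lor_self_ne_zero {n : ℕ} (hn : 1 ≤ n) {x : Vec n} (hx : lor n x x ≠ 0) :
    ∃ v, lor n x v = 0 ∧ lor n v v ≠ 0 := by
  by_contra! H
  -- If every vector orthogonal to `x` were null, so would be the projections of the basis vectors.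
  -- Their squares, weighted by the signs `J i i`, add up to the trace of the projection, `(n + 1) -
  -- 1`, which would then be zero.
  let e : Fin (n + 1) → Vec n := fun i => Pi.single i 1
  have key : ∀ i, J n i i * J n i i - (J n i i * x i * x i) / lor n x x = 0 := by
    intro i
    have h := H (e i - (lor n x (e i) / lor n x x) • x) (by
      rw [map_sub, map_smul, smul_eq_mul]; field_simp; ring)
    simp only [map_sub, map_smul, LinearMap.sub_apply, LinearMap.smul_apply, smul_eq_mul] at h
    rw [lor_comm (e i) x] at h
    simp only [e, lor_single, Pi.single_eq_same, mul_one] at h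
    have hj := J_apply_self_mul_self i
    have h' := congrArg (J n i i * ·) h
    simp only [mul_zero] at h'
    rw [← h']
    field_simp
    linear_combination (J n i i * x i ^ 2) * hj
  have hs : ∑ i, J n i i * x i * x i = lor n x x := by
    rw [lor_eq, Fin.sum_univ_succ]
    simp [J, sub_eq_add_neg]
  have h0 : ∑ i, (J n i i * J n i i - (J n i i * x i * x i) / lor n x x) = 0 :=
    Finset.sum_eq_zero fun i _ => key i
  rw [Finset.sum_sub_distrib, ← Finset.sum_div, hs, div_self hx] at h0
  simp only [J_apply_self_mul_self] at h0
  simp at h0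
  omega

/-- If `x - y` is non-null, its reflection takes `x` to `y`, and a prior reflection fixing `x`
corrects the determinant. Otherwise `x + y` is non-null, since the squares of `x - y` and `x + y`
add up to `4 (x,x)₋₁`; its reflection takes `x` to `-y`, and the reflection in `y` takes `-y` to
`y`. For `n = 0` the group is trivial and the claim fails. -/
theorem exists_toMat_mulVec_eq {n : ℕ} (hn : 1 ≤ n) {x y : Vec n} (hx : lor n x x ≠ 0)
    (hxy : lor n y y = lor n x x) : ∃ h : SO1 n, toMat h *ᵥ x = y := by
  have hc := lor_comm y x
  by_cases hd : lor n (x - y) (x - y) = 0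
  · have hs : lor n (x + y) (x + y) ≠ 0 := by
      simp only [map_add, map_sub, LinearMap.add_apply, LinearMap.sub_apply] at hd ⊢
      intro h
      apply hx
      linarith
    obtain ⟨h, hh⟩ := exists_SO1_of_refl (hxy.trans_ne hx) hs
    refine ⟨h, ?_⟩
    have e1 : 2 / lor n (x + y) (x + y) * lor n (x + y) x = 1 := by
      field_simp
      simp only [map_add, LinearMap.add_apply]
      linarith
    have e2 : 2 / lor n y y * lor n y y = 2 := by
      have := hxy.trans_ne hx
      field_simp
    rw [hh, ← mulVec_mulVec, refl_mulVec (x + y), e1, one_smul, sub_add_cancel_left, refl_mulVec,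
      map_neg, mul_neg, e2]
    module
  · obtain ⟨v, hv, hvv⟩ := exists_lor_eq_zero_lor_self_ne_zero hn hx
    obtain ⟨h, hh⟩ := exists_SO1_of_refl hd hvv
    refine ⟨h, ?_⟩
    have e1 : 2 / lor n (x - y) (x - y) * lor n (x - y) x = 1 := by
      field_simp
      simp only [map_sub, LinearMap.sub_apply]
      linarith
    rw [hh, ← mulVec_mulVec, refl_mulVec v, lor_comm v x, hv, mul_zero, zero_smul, sub_zero,
      refl_mulVec, e1, one_smul, sub_sub_cancel]

/-! ### The coadjoint orbit -/

/-- An element of `Sym₋₁` with prescribed value at a non-null vector `x`, up to multiples of `x`. -/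
theorem exists_symm_mulVec {n : ℕ} {x y : Vec n} (hx : lor n x x ≠ 0) (h : lor n x y = 0) :
    ∃ A ∈ symm n, A *ᵥ x = y := by
  refine ⟨(lor n x x)⁻¹ • (dyad y x + dyad x y),
    Submodule.smul_mem _ _ (dyad_add_dyad_mem_symm (by rw [lor_comm, h])), ?_⟩
  rw [smul_mulVec, add_mulVec, dyad_mulVec, dyad_mulVec, lor_comm y x, h, zero_smul, add_zero,
    inv_smul_smul₀ hx]

theorem trace_rankOne_add_wedge {n : ℕ} (x y z : Vec n) : (rankOne x + wedge y z).trace = 0 := by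
  rw [trace_add, (mem_symm.1 (rankOne_mem_symm x)).2, trace_eq_zero_of_mem_so (wedge_mem_so y z),
    add_zero]

theorem rankOne_comm {n : ℕ} (x : Vec n) (M : Mat n) :
    rankOne x * M - M * rankOne x = dyad x x * M - dyad (M *ᵥ x) x := by
  rw [rankOne, tensor_eq, sub_mul, mul_sub, mul_dyad, smul_mul_assoc, mul_smul_comm, one_mul,
    mul_one]
  abel

/-- This is how the translation part of the group creates the fibre directions of the cotangent
bundle. -/
theorem rankOne_comm_symm {n : ℕ} {A : Mat n} (hA : A ∈ symm n) (x : Vec n) :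
    rankOne x * A - A * rankOne x = wedge x (A *ᵥ x) := by
  rw [rankOne_comm, dyad_mul_symm hA, wedge_eq]

theorem rankOne_comm_so {n : ℕ} {B : Mat n} (hB : B ∈ so n) (x : Vec n) :
    rankOne x * B - B * rankOne x = -(dyad x (B *ᵥ x) + dyad (B *ᵥ x) x) := by
  rw [rankOne_comm, dyad_mul_so hB]
  abel

theorem conj_dyad {n : ℕ} (h : SO1 n) (x y : Vec n) :
    toMat h⁻¹ * dyad x y * toMat h = dyad (toMat h⁻¹ *ᵥ x) (toMat h⁻¹ *ᵥ y) := by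
  rw [mul_dyad, dyad_mul_toMat]

theorem conj_rankOne {n : ℕ} (h : SO1 n) (x : Vec n) :
    toMat h⁻¹ * rankOne x * toMat h = rankOne (toMat h⁻¹ *ᵥ x) := by
  rw [rankOne, rankOne, mul_sub, sub_mul, tensor_eq, conj_dyad, lor_toMat_mulVec, mul_smul_comm,
    smul_mul_assoc, mul_one, toMat_inv_mul, tensor_eq]

theorem toDual_rankOne_comp_Ad {n : ℕ} (x : Vec n) (g : Gs n) :
    toDual (rankOne x) ∘ₗ Ad g =
      toDual (rankOne (toMat g.right⁻¹ *ᵥ x) +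
        wedge (toMat g.right⁻¹ *ᵥ x) (toMat g.right⁻¹ *ᵥ (g.vec *ᵥ x))) := by
  rw [toDual_comp_Ad (rankOne_mem_symm x), rankOne_comm_symm g.vec_mem, mul_add, add_mul,
    conj_rankOne, wedge_eq, mul_sub, sub_mul, conj_dyad, conj_dyad, ← wedge_eq]

theorem mem_orbit_rankOne {n : ℕ} (x : Vec n) (L : Mat n) :
    L ∈ orbit (rankOne x) ↔ ∃ (h : SO1 n) (A : Mat n), A ∈ symm n ∧
      L = rankOne (toMat h *ᵥ x) + wedge (toMat h *ᵥ x) (toMat h *ᵥ (A *ᵥ x)) := by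
  constructor
  · rintro ⟨hL, g, hg⟩
    -- The orbit is defined with `Ad g⁻¹`, and the formula for `Ad` involves the inverse rotation,
    -- hence the double inversion.
    refine ⟨(g⁻¹).right⁻¹, (g⁻¹).vec, (g⁻¹).vec_mem, ?_⟩
    rw [toDual_rankOne_comp_Ad] at hg
    exact eq_of_toDual_eq hL (trace_rankOne_add_wedge _ _ _) hg
  · rintro ⟨h, A, hA, rfl⟩
    refine ⟨trace_rankOne_add_wedge _ _ _,
      (⟨Multiplicative.ofAdd ⟨A, hA⟩, h⁻¹⟩ : Gs n)⁻¹, ?_⟩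
    rw [inv_inv, toDual_rankOne_comp_Ad, inv_inv]
    rfl

/-- The component of `y` orthogonal to `x` gives the same bivector with `x`. -/
theorem exists_lor_eq_zero_wedge_eq {n : ℕ} {x : Vec n} (hx : lor n x x ≠ 0) (y : Vec n) :
    ∃ z, lor n x z = 0 ∧ wedge x z = wedge x y := by
  refine ⟨y + (-(lor n x y / lor n x x)) • x, ?_, ?_⟩
  · rw [map_add, map_smul, smul_eq_mul]
    field_simp
    ring
  · rw [wedge_add_right, wedge_smul_self, add_zero]

theorem image_orbitMap {n : ℕ} (hn : 1 ≤ n) {x₀ : Vec n} (hx₀ : lor n x₀ x₀ ≠ 0) :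
    orbitMap '' quadricBundle n (lor n x₀ x₀) = orbit (rankOne x₀) := by
  ext L
  rw [mem_orbit_rankOne]
  constructor
  · rintro ⟨⟨x, y⟩, ⟨h1, h2⟩, rfl⟩
    obtain ⟨h, rfl⟩ := exists_toMat_mulVec_eq hn hx₀ h1
    -- Rotating `y` back to `x₀` keeps it orthogonal, so it is the value at `x₀` of some element of
    -- `Sym₋₁`.
    have h3 : lor n x₀ (toMat h⁻¹ *ᵥ y) = 0 := by
      rw [← lor_toMat_mulVec h, mulVec_mulVec, toMat_mul_inv, one_mulVec, h2]
    obtain ⟨A, hA, hAx⟩ := exists_symm_mulVec hx₀ h3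
    refine ⟨h, A, hA, ?_⟩
    rw [hAx, mulVec_mulVec _ (toMat h) (toMat h⁻¹), toMat_mul_inv, one_mulVec, orbitMap]
  · rintro ⟨h, A, -, rfl⟩
    have h1 := lor_toMat_mulVec h x₀ x₀
    obtain ⟨z, hz, hw⟩ := exists_lor_eq_zero_wedge_eq (h1.trans_ne hx₀) (toMat h *ᵥ (A *ᵥ x₀))
    exact ⟨(toMat h *ᵥ x₀, z), ⟨h1, hz⟩, by rw [orbitMap, hw]⟩

theorem orbit_rankOne {n : ℕ} (hn : 1 ≤ n) {x₀ : Vec n} (hx₀ : lor n x₀ x₀ ≠ 0) :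
    orbit (rankOne x₀) =
      {L | ∃ x y : Vec n, lor n x x = lor n x₀ x₀ ∧
        L = tensor x - (lor n x₀ x₀ / ((n : ℝ) + 1)) • (1 : Mat n) + wedge x y} := by
  rw [← image_orbitMap hn hx₀]
  ext L
  constructor
  · rintro ⟨⟨x, y⟩, ⟨h1, h2⟩, rfl⟩
    exact ⟨x, y, h1, by rw [← h1]; rfl⟩
  · rintro ⟨x, y, h1, rfl⟩
    obtain ⟨z, hz, hw⟩ := exists_lor_eq_zero_wedge_eq (h1.trans_ne hx₀) y
    exact ⟨(x, z), ⟨h1, hz⟩, by rw [orbitMap, hw, ← h1]; rfl⟩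

/-! ### The cotangent bundle of the quadric -/

/-- Since `x` is non-null, the space is the direct sum of the line of `x` and its orthogonal
complement, so the form is nondegenerate on the complement. -/
theorem bijOn_covector {n : ℕ} {x : Vec n} (hx : lor n x x ≠ 0) :
    BijOn (covector x) {y | lor n x y = 0} univ := by
  have hp : ∀ w, lor n x (w - (lor n x w / lor n x x) • x) = 0 := fun w => by
    rw [map_sub, map_smul, smul_eq_mul, div_mul_cancel₀ _ hx, sub_self]
  have hpy : ∀ y w, lor n x y = 0 → lor n y (w - (lor n x w / lor n x x) • x) = lor n y w :=
    fun y w hy => by rw [map_sub, map_smul, lor_comm y x, hy, smul_zero, sub_zero]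
  refine ⟨mapsTo_univ _ _, fun y hy z hz h => ?_, fun φ _ => ?_⟩
  · refine sub_eq_zero.1 (eq_zero_of_lor fun w => ?_)
    have h1 : lor n y (w - (lor n x w / lor n x x) • x) =
        lor n z (w - (lor n x w / lor n x x) • x) :=
      LinearMap.congr_fun h ⟨_, hp w⟩
    rw [hpy y w hy, hpy z w hz] at h1
    rw [map_sub, LinearMap.sub_apply, h1, sub_self]
  -- A covector is extended by the projection `π` along `x`. The extension has Euclidean
  -- representative `v`, hence Lorentzian representative `J v`, which is orthogonal to `x` because
  -- `π x = 0`.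
  · let π : Vec n →ₗ[ℝ] LinearMap.ker (lor n x) :=
      LinearMap.codRestrict _ (LinearMap.id - ((lor n x x)⁻¹ • lor n x).smulRight x) fun w => by
        have := hp w
        rw [div_eq_inv_mul] at this
        simpa using this
    let v : Vec n := fun i => φ (π (Pi.single i 1))
    have hv : ∀ w, lor n (J n *ᵥ v) w = φ (π w) := fun w => by
      rw [lor_comm, lor_apply, mulVec_mulVec, J_mul_J, one_mulVec]
      conv_rhs => rw [pi_eq_sum_univ' w]
      simp only [map_sum, map_smul, smul_eq_mul, dotProduct, v]
    refine ⟨J n *ᵥ v, ?_, ?_⟩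
    · have h0 : π x = 0 := by
        ext1
        simp [π, inv_mul_cancel₀ hx]
      change lor n x _ = 0
      rw [lor_comm, hv, h0, map_zero]
    · ext ⟨w, hw⟩
      have h0 : π w = ⟨w, hw⟩ := by
        ext1
        simp [π, LinearMap.mem_ker.1 hw]
      rw [← h0, ← hv w, h0]
      rfl

theorem canonicalForm_eq {n : ℕ} (q v w : Vec n × Vec n) :
    canonicalForm q v w = lor n v.1 w.2 - lor n w.1 v.2 := by
  have h : ∀ a b : Vec n × Vec n,
      fderiv ℝ (fun q' : Vec n × Vec n => tautForm q' a) q b = lor n b.2 a.1 := fun a b => by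
    let T : Vec n × Vec n →L[ℝ] ℝ :=
      LinearMap.toContinuousLinearMap ((lor n).flip a.1 ∘ₗ LinearMap.snd ℝ (Vec n) (Vec n))
    have hT : (fun q' : Vec n × Vec n => tautForm q' a) = T := rfl
    rw [hT, ContinuousLinearMap.fderiv]
    rfl
  rw [canonicalForm, h, h, lor_comm v.2, lor_comm w.2]
  ring

/-! ### The covering of the orbit -/

/-- The components in `Sym₋₁` and `so(1,n)` of a matrix are unique. -/
theorem eq_and_eq_of_add_eq_add {n : ℕ} {P P' W W' : Mat n} (hP : P ∈ symm n) (hP' : P' ∈ symm n)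
    (hW : W ∈ so n) (hW' : W' ∈ so n) (h : P + W = P' + W') : P = P' ∧ W = W' := by
  have h1 : P - P' = W' - W := by linear_combination (norm := abel) h
  have hs := (symm n).sub_mem hP hP'
  have hk := (so n).sub_mem hW' hW
  rw [← h1] at hk
  -- The difference `P - P'` is both self-adjoint and skew, hence equal to its own negative.
  have e := (mem_symm.1 hs).1.symm.trans (mem_so.1 hk)
  have e' := congrArg (J n * ·) e
  simp only [← mul_assoc, J_mul_J, one_mul] at e'
  have h2 : P - P' = 0 := by
    ext i j
    have h3 := congrFun (congrFun e' i) j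
    rw [neg_apply] at h3
    change (P - P') i j = 0
    linarith
  refine ⟨sub_eq_zero.1 h2, ?_⟩
  rw [h2] at h1
  exact (sub_eq_zero.1 h1.symm).symm

theorem wedge_mulVec_self {n : ℕ} {x y : Vec n} (h : lor n x y = 0) :
    wedge x y *ᵥ x = -(lor n x x • y) := by
  rw [wedge_mulVec, lor_comm y x, h, zero_smul, zero_sub]

theorem orbitMap_neg {n : ℕ} (q : Vec n × Vec n) : orbitMap (-q) = orbitMap q := by
  simp [orbitMap, rankOne, tensor_eq, wedge_eq]

theorem orbitMap_eq_iff {n : ℕ} {r : ℝ} (hr : r ≠ 0) {q q' : Vec n × Vec n}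
    (hq : q ∈ quadricBundle n r) (hq' : q' ∈ quadricBundle n r) :
    orbitMap q = orbitMap q' ↔ q' = q ∨ q' = -q := by
  refine ⟨fun h => ?_, ?_⟩
  · obtain ⟨x, y⟩ := q
    obtain ⟨x', y'⟩ := q'
    obtain ⟨h1, h2⟩ := hq
    obtain ⟨h1', h2'⟩ := hq'
    dsimp only at h1 h2 h1' h2'
    obtain ⟨hP, hW⟩ := eq_and_eq_of_add_eq_add (rankOne_mem_symm _) (rankOne_mem_symm _)
      (wedge_mem_so _ _) (wedge_mem_so _ _) h
    dsimp only at hP hW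
    have hy : ∀ {z w : Vec n}, r • z = r • w → z = w := fun e => smul_right_injective _ hr e
    have e1 := congrArg (· *ᵥ x') hP
    simp only [rankOne_mulVec, h1, h1', sub_left_inj] at e1
    have e2 : x' = (lor n x x' / r) • x := hy (by rw [← e1, smul_smul, mul_div_cancel₀ _ hr])
    set c := lor n x x' / r
    -- Proportional vectors with the same nonzero square differ by a sign.
    have hc : c * c = 1 := by
      rw [e2] at h1'
      simp only [map_smul, LinearMap.smul_apply, smul_eq_mul, h1] at h1'
      exact mul_right_cancel₀ hr (by linarith)
    rcases mul_self_eq_one_iff.1 hc with hc | hc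
    · rw [hc, one_smul] at e2
      subst e2
      have e3 := congrArg (· *ᵥ x') hW
      simp only [wedge_mulVec_self h2, wedge_mulVec_self h2', h1, neg_inj] at e3
      exact Or.inl (Prod.ext rfl (hy e3).symm)
    · rw [hc, neg_one_smul] at e2
      subst e2
      have e3 := congrArg (· *ᵥ (-x)) hW
      simp only [wedge_mulVec_self h2', h1'] at e3
      rw [mulVec_neg, wedge_mulVec_self h2, h1, neg_neg, ← smul_neg] at e3
      refine Or.inr (Prod.ext rfl ?_)
      rw [Prod.snd_neg, hy e3, neg_neg]
  · rintro (rfl | rfl)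
    · rfl
    · rw [orbitMap_neg]

/-! ### The differential of the covering -/

/-- The bilinear map whose diagonal is `orbitMap`. -/
noncomputable def orbitBilin (n : ℕ) : Vec n × Vec n →ₗ[ℝ] Vec n × Vec n →ₗ[ℝ] Mat n :=
  LinearMap.mk₂ ℝ (fun q q' => dyad q.1 q'.1 - (lor n q.1 q'.1 / ((n : ℝ) + 1)) • (1 : Mat n) +
      wedge q.1 q'.2)
    (fun _ _ _ => by
      simp only [wedge_eq, Prod.fst_add, map_add, LinearMap.add_apply]
      module)
    (fun _ _ _ => by
      simp only [wedge_eq, Prod.smul_fst, map_smul, LinearMap.smul_apply, smul_eq_mul]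
      module)
    (fun _ _ _ => by
      simp only [wedge_eq, Prod.fst_add, Prod.snd_add, map_add, LinearMap.add_apply]
      module)
    (fun _ _ _ => by
      simp only [wedge_eq, Prod.smul_fst, Prod.smul_snd, map_smul, LinearMap.smul_apply, smul_eq_mul]
      module)

theorem orbitBilin_apply {n : ℕ} (q q' : Vec n × Vec n) : orbitBilin n q q' =
    dyad q.1 q'.1 - (lor n q.1 q'.1 / ((n : ℝ) + 1)) • (1 : Mat n) + wedge q.1 q'.2 := rfl

theorem contDiff_orbitMap {n : ℕ} : ContDiff ℝ ∞ (orbitMap (n := n)) := by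
  have h := ((orbitBilin n).toContinuousBilinearMap.isBoundedBilinearMap.contDiff (n := ∞)).comp
    (contDiff_id.prodMk contDiff_id)
  exact h

theorem fderiv_orbitMap_apply {n : ℕ} (q v : Vec n × Vec n) :
    fderiv ℝ orbitMap q v = orbitBilin n q v + orbitBilin n v q := by
  have h := HasFDerivAt.comp (f := fun q : Vec n × Vec n => (q, q)) q
    ((orbitBilin n).toContinuousBilinearMap.isBoundedBilinearMap.hasFDerivAt (q, q))
    ((hasFDerivAt_id q).prodMk (hasFDerivAt_id q))
  have h' : HasFDerivAt (orbitMap (n := n)) _ q := h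
  rw [h'.fderiv]
  rfl

/-- Along the quadric `(x,x)₋₁` is constant, so the multiple of the identity contributes nothing. -/
theorem fderiv_orbitMap {n : ℕ} {q v : Vec n × Vec n} (hv : lor n q.1 v.1 = 0) :
    fderiv ℝ orbitMap q v =
      (dyad q.1 v.1 + dyad v.1 q.1) + (wedge q.1 v.2 + wedge v.1 q.2) := by
  rw [fderiv_orbitMap_apply, orbitBilin_apply, orbitBilin_apply, lor_comm v.1, hv, zero_div,
    zero_smul, sub_zero, sub_zero]
  abel

/-- The tangent vector of the orbit at `orbitMap q` defined by an element of the Lie algebra. -/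
theorem coad_toDual_orbitMap {n : ℕ} (q : Vec n × Vec n) (M : LieGs n) :
    coad M (toDual (orbitMap q)) =
      toDual (fderiv ℝ orbitMap q (-(M.k *ᵥ q.1), M.p *ᵥ q.1 - M.k *ᵥ q.2)) := by
  have h : lor n q.1 (-(M.k *ᵥ q.1)) = 0 := by
    rw [map_neg, lor_so_mulVec_self M.k_mem, neg_zero]
  rw [orbitMap, coad_toDual (rankOne_mem_symm _) (wedge_mem_so _ _), fderiv_orbitMap h,
    rankOne_comm_symm M.p_mem, rankOne_comm_so M.k_mem]
  congr 1
  -- The remaining commutator is `[x ∧ y, B] = -(Bx ∧ y + x ∧ By)`.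
  simp only [wedge_eq, sub_mul, mul_sub, dyad_mul_so M.k_mem, mul_dyad, map_neg, map_sub,
    LinearMap.neg_apply, LinearMap.sub_apply]
  abel

/-- Every tangent vector of the bundle comes from the Lie algebra, up to a fibre direction that
`orbitMap` does not see. -/
theorem exists_lieGs_of_mem_bundleTangent {n : ℕ} {q v : Vec n × Vec n} (hq : lor n q.1 q.1 ≠ 0)
    (hv : v ∈ bundleTangent q) :
    ∃ M : LieGs n, -(M.k *ᵥ q.1) = v.1 ∧ M.p *ᵥ q.1 - M.k *ᵥ q.2 = v.2 := by
  obtain ⟨h1, h2⟩ := hv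
  -- Scaled so that `B x = -ẋ`, because `(ẋ ∧ x) x = (x,x)₋₁ ẋ` when `ẋ` is orthogonal to `x`.
  let B : Mat n := -((lor n q.1 q.1)⁻¹ • wedge v.1 q.1)
  have hB : B ∈ so n := (so n).neg_mem (Submodule.smul_mem _ _ (wedge_mem_so _ _))
  have hB1 : B *ᵥ q.1 = -v.1 := by
    simp only [B, neg_mulVec, smul_mulVec, wedge_mulVec]
    rw [lor_comm v.1, h1, zero_smul, sub_zero, inv_smul_smul₀ hq]
  have hB2 : lor n q.1 (B *ᵥ q.2) = lor n v.1 q.2 := by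
    have h := lor_so_mulVec hB q.1 q.2
    rw [hB1, map_neg, LinearMap.neg_apply] at h
    linarith
  -- The orthogonality required for `A` is exactly the second tangency equation.
  obtain ⟨A, hA, hA1⟩ := exists_symm_mulVec (x := q.1) (y := v.2 + B *ᵥ q.2) hq (by
    rw [map_add, hB2]; linarith)
  exact ⟨LieGs.mk A B hA hB, by rw [LieGs.k_mk, hB1, neg_neg],
    by rw [LieGs.p_mk, LieGs.k_mk, hA1, add_sub_cancel_right]⟩

theorem trace_fderiv_orbitMap {n : ℕ} {q v : Vec n × Vec n} (hv : lor n q.1 v.1 = 0) :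
    (fderiv ℝ orbitMap q v).trace = 0 := by
  rw [fderiv_orbitMap hv, trace_add, trace_add, trace_add, trace_dyad, trace_dyad,
    trace_eq_zero_of_mem_so (wedge_mem_so _ _), trace_eq_zero_of_mem_so (wedge_mem_so _ _),
    lor_comm v.1, hv]
  simp

theorem bijOn_fderiv_orbitMap {n : ℕ} {q : Vec n × Vec n} (hq : lor n q.1 q.1 ≠ 0) :
    BijOn (fderiv ℝ orbitMap q) (bundleTangent q) (orbitTangent (orbitMap q)) := by
  refine ⟨fun v hv => ?_, fun v hv w hw h => ?_, ?_⟩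
  · obtain ⟨M, h1, h2⟩ := exists_lieGs_of_mem_bundleTangent hq hv
    refine ⟨trace_fderiv_orbitMap hv.1, M, ?_⟩
    rw [coad_toDual_orbitMap, h1, h2]
  · have hd1 : lor n q.1 (v - w).1 = 0 := by
      rw [Prod.fst_sub, map_sub, hv.1, hw.1, sub_zero]
    have hd2 : lor n (v - w).1 q.2 + lor n q.1 (v - w).2 = 0 := by
      have := hv.2
      have := hw.2
      simp only [Prod.fst_sub, Prod.snd_sub, map_sub, LinearMap.sub_apply]
      linarith
    have h0 : fderiv ℝ orbitMap q (v - w) = 0 := by rw [map_sub, h, sub_self]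
    rw [← sub_eq_zero]
    generalize v - w = u at hd1 hd2 h0
    rw [fderiv_orbitMap hd1] at h0
    obtain ⟨e1, e2⟩ := eq_and_eq_of_add_eq_add (dyad_add_dyad_mem_symm hd1) (symm n).zero_mem
      ((so n).add_mem (wedge_mem_so _ _) (wedge_mem_so _ _)) (so n).zero_mem
      (h0.trans (add_zero 0).symm)
    -- Evaluating the self-adjoint part at `x` isolates `ẋ`; with `ẋ = 0`, the skew part at `x`
    -- isolates `ẏ`.
    have e3 := congrArg (· *ᵥ q.1) e1
    simp only [add_mulVec, dyad_mulVec, zero_mulVec] at e3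
    rw [lor_comm u.1, hd1, zero_smul, zero_add] at e3
    have hu1 : u.1 = 0 := (smul_eq_zero.1 e3).resolve_left hq
    rw [hu1, map_zero, LinearMap.zero_apply, zero_add] at hd2
    have e4 := congrArg (· *ᵥ q.1) e2
    simp only [add_mulVec, wedge_mulVec_self hd2, zero_mulVec, wedge_mulVec, hu1] at e4
    simp only [map_zero, LinearMap.zero_apply, zero_smul, smul_zero, sub_zero, add_zero,
      neg_eq_zero] at e4
    exact Prod.ext hu1 ((smul_eq_zero.1 e4).resolve_left hq)
  · rintro V ⟨hV, M, hM⟩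
    rw [coad_toDual_orbitMap] at hM
    have h1 : lor n q.1 (-(M.k *ᵥ q.1)) = 0 := by
      rw [map_neg, lor_so_mulVec_self M.k_mem, neg_zero]
    have e := eq_of_toDual_eq hV (trace_fderiv_orbitMap (v := (_, _)) h1) hM
    set a := M.p *ᵥ q.1 - M.k *ᵥ q.2
    set b := -(M.k *ᵥ q.1)
    -- The pair `(-Bx, Ax - By)` may violate the second tangency equation. Adding a multiple of `x`
    -- to its fibre component repairs this, and `x ∧ x = 0` leaves the derivative unchanged.
    let c : ℝ := -((lor n b q.2 + lor n q.1 a) / lor n q.1 q.1)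
    refine ⟨(b, a + c • q.1), ⟨h1, ?_⟩, ?_⟩
    · change lor n b q.2 + lor n q.1 (a + c • q.1) = 0
      rw [map_add, map_smul, smul_eq_mul]
      simp only [c]
      field_simp
      ring
    · rw [e, fderiv_orbitMap (v := (_, _)) h1, fderiv_orbitMap (v := (_, _)) h1, wedge_add_right,
        wedge_smul_self, add_zero]

/-- `orbitMap` carries the form of the orbit to the canonical form. -/
theorem orbitForm_fderiv_orbitMap {n : ℕ} {q v w : Vec n × Vec n} (hq : lor n q.1 q.1 ≠ 0)
    (hv : v ∈ bundleTangent q) (hw : w ∈ bundleTangent q) :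
    orbitForm (orbitMap q) (fderiv ℝ orbitMap q w) (fderiv ℝ orbitMap q v) =
      canonicalForm q v w := by
  obtain ⟨M, h1, h2⟩ := exists_lieGs_of_mem_bundleTangent hq hv
  obtain ⟨N, h3, h4⟩ := exists_lieGs_of_mem_bundleTangent hq hw
  have hM := coad_toDual_orbitMap q M
  have hN := coad_toDual_orbitMap q N
  rw [h1, h2] at hM
  rw [h3, h4] at hN
  -- The value `⟨L, [N, M]⟩` is the tangent vector defined by `N` evaluated at `M`, so only the
  -- derivative along `w` has to be paired with `M`.
  rw [orbitForm, ← hM, ← hN, coadForm_coad, ← coad_apply, hN, toDual_apply, fderiv_orbitMap hw.1,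
    canonicalForm_eq]
  have e1 := trace_symm_mul_so (dyad_add_dyad_mem_symm hw.1) M.k_mem
  have e2 := trace_so_mul_symm M.p_mem
    ((so n).add_mem (wedge_mem_so q.1 w.2) (wedge_mem_so w.1 q.2))
  rw [add_mul, mul_add, mul_add, trace_add, trace_add, trace_add, e1, e2, add_mul, add_mul,
    trace_add, trace_add, trace_dyad_mul, trace_dyad_mul, trace_wedge_mul_so M.k_mem,
    trace_wedge_mul_so M.k_mem, lor_symm_mulVec M.p_mem w.1, lor_comm q.2,
    lor_so_mulVec M.k_mem w.1, lor_comm (M.p *ᵥ q.1)]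
  -- Eliminating `M` in favour of `v` leaves two copies of `(ẋ_w, B y)₋₁` with opposite signs.
  have f1 : lor n w.1 (M.p *ᵥ q.1) = lor n w.1 v.2 + lor n w.1 (M.k *ᵥ q.2) := by
    rw [← h2, map_sub]; ring
  have f2 : lor n w.2 (M.k *ᵥ q.1) = -lor n v.1 w.2 := by
    rw [← h1, lor_comm _ w.2, map_neg, neg_neg]
  rw [f1, f2]
  ring

/-! ### The orbit as the cotangent bundle of the hyperboloid -/

theorem dyad_self_apply_zero {n : ℕ} (x : Vec n) (i : Fin (n + 1)) : dyad x x i 0 = x i * x 0 := by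
  rw [dyad_apply, vecMulVec_apply, J_mulVec_zero]

theorem apply_zero_ne_zero {n : ℕ} {x : Vec n} (hx : 0 < lor n x x) : x 0 ≠ 0 := by
  intro h
  rw [lor_eq, h] at hx
  have : 0 ≤ ∑ i : Fin n, x i.succ * x i.succ := Finset.sum_nonneg fun i _ => mul_self_nonneg _
  linarith

/-- A vector of positive square has nonzero time coordinate, so exactly one point of each fibre `{q,
-q}` lies on the chosen sheet. -/
theorem bijOn_orbitMap {n : ℕ} (hn : 1 ≤ n) {x₀ : Vec n} (hx₀ : 0 < lor n x₀ x₀) :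
    BijOn orbitMap (hyperboloidBundle n (lor n x₀ x₀)) (orbit (rankOne x₀)) := by
  rw [← image_orbitMap hn hx₀.ne']
  refine ⟨fun q hq => ⟨q, hq.1, rfl⟩, fun q hq q' hq' h => ?_, ?_⟩
  · rcases (orbitMap_eq_iff hx₀.ne' hq.1 hq'.1).1 h with h | h
    · exact h.symm
    · have h1 := hq.2
      have h2 := hq'.2
      rw [h, Prod.fst_neg, Pi.neg_apply] at h2
      linarith
  · rintro _ ⟨q, hq, rfl⟩
    have h0 : q.1 0 ≠ 0 := apply_zero_ne_zero (hx₀.trans_eq hq.1.symm)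
    rcases lt_or_gt_of_ne h0 with h | h
    · refine ⟨-q, ⟨⟨?_, ?_⟩, ?_⟩, orbitMap_neg q⟩
      · simpa using hq.1
      · simpa using hq.2
      · simpa using h
    · exact ⟨q, ⟨hq, h⟩, rfl⟩

/-! ### The smooth inverse on the hyperboloid. -/

/-- The component in `Sym₋₁ ⊕ ℝ I` of a matrix. -/
noncomputable def selfAdjPart (n : ℕ) : Mat n →ₗ[ℝ] Mat n :=
  (1 / 2 : ℝ) • (LinearMap.id + LinearMap.mulRight ℝ (J n) ∘ₗ LinearMap.mulLeft ℝ (J n) ∘ₗ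
    (transposeLinearEquiv _ _ ℝ ℝ).toLinearMap)

theorem selfAdjPart_add {n : ℕ} {P W : Mat n} (hP : P ∈ symm n) (hW : W ∈ so n) :
    selfAdjPart n (P + W) = P := by
  have h1 : J n * Pᵀ * J n = P := by
    rw [mul_assoc, (mem_symm.1 hP).1, ← mul_assoc, J_mul_J, one_mul]
  have h2 : J n * Wᵀ * J n = -W := by
    rw [mul_assoc, mem_so.1 hW, ← mul_assoc, J_mul_J, one_mul]
  have h : selfAdjPart n (P + W) = (1 / 2 : ℝ) • (P + W + J n * (P + W)ᵀ * J n) := rfl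
  rw [h, transpose_add, mul_add, add_mul, h1, h2]
  module

/-- On the orbit, the matrix `(x ⊗ x)₋₁`. -/
noncomputable def tensorPart (n : ℕ) (r : ℝ) (L : Mat n) : Mat n :=
  selfAdjPart n L + (r / ((n : ℝ) + 1)) • (1 : Mat n)

theorem tensorPart_orbitMap {n : ℕ} {r : ℝ} {q : Vec n × Vec n} (hq : lor n q.1 q.1 = r) :
    tensorPart n r (orbitMap q) = dyad q.1 q.1 := by
  rw [tensorPart, orbitMap, selfAdjPart_add (rankOne_mem_symm _) (wedge_mem_so _ _), rankOne, hq,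
    sub_add_cancel, tensor_eq]

theorem contDiff_tensorPart (n : ℕ) (r : ℝ) : ContDiff ℝ ∞ (tensorPart n r) := by
  have h : ContDiff ℝ ∞ (selfAdjPart n) :=
    (LinearMap.toContinuousLinearMap (selfAdjPart n)).contDiff
  exact h.add contDiff_const

/-- The entries of a matrix depend smoothly on it. -/
theorem contDiff_entry {n : ℕ} (i j : Fin (n + 1)) : ContDiff ℝ ∞ fun L : Mat n => L i j :=
  (LinearMap.toContinuousLinearMap (Matrix.entryLinearMap ℝ ℝ i j)).contDiff

/-- The point `x` of the hyperboloid, reconstructed from `orbitMap (x, y)`. -/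
noncomputable def basePoint (n : ℕ) (r : ℝ) (L : Mat n) : Vec n :=
  fun i => tensorPart n r L i 0 / √(tensorPart n r L 0 0)

/-- The inverse of `orbitMap` on the cotangent bundle of the hyperboloid. -/
noncomputable def orbitInv (n : ℕ) (r : ℝ) (L : Mat n) : Vec n × Vec n :=
  (basePoint n r L, fun i => -(r⁻¹ * ((L - selfAdjPart n L) *ᵥ basePoint n r L) i))

theorem orbitInv_orbitMap {n : ℕ} {r : ℝ} (hr : r ≠ 0) {q : Vec n × Vec n}
    (hq : q ∈ hyperboloidBundle n r) : orbitInv n r (orbitMap q) = q := by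
  obtain ⟨⟨h1, h2⟩, h3⟩ := hq
  have hb : basePoint n r (orbitMap q) = q.1 := by
    funext i
    -- The first column of `x ⊗ Jx` is `x` times its time coordinate, and the root of the corner
    -- entry is that coordinate because it is positive.
    rw [basePoint, tensorPart_orbitMap h1, dyad_self_apply_zero, dyad_self_apply_zero,
      Real.sqrt_mul_self h3.le, mul_div_cancel_right₀ _ h3.ne']
  have hw : orbitMap q - selfAdjPart n (orbitMap q) = wedge q.1 q.2 := by
    rw [orbitMap, selfAdjPart_add (rankOne_mem_symm _) (wedge_mem_so _ _), add_sub_cancel_left]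
  refine Prod.ext hb ?_
  funext i
  rw [orbitInv, hw, hb, wedge_mulVec_self h2, h1]
  simp [hr]

/-- Positivity of the corner entry keeps the square root smooth and the quotient regular. -/
theorem contDiffOn_orbitInv (n : ℕ) (r : ℝ) :
    ContDiffOn ℝ ∞ (orbitInv n r) {L | 0 < tensorPart n r L 0 0} := by
  have ht : ∀ i, ContDiff ℝ ∞ fun L => tensorPart n r L i 0 := fun i =>
    (contDiff_entry i 0).comp (contDiff_tensorPart n r)
  have hb : ∀ i, ContDiffOn ℝ ∞ (fun L => basePoint n r L i) {L | 0 < tensorPart n r L 0 0} :=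
    fun i => (ht i).contDiffOn.div ((ht 0).contDiffOn.sqrt fun L hL => ne_of_gt hL)
      fun L hL => (Real.sqrt_pos.2 hL).ne'
  have hs : ContDiff ℝ ∞ (selfAdjPart n) :=
    (LinearMap.toContinuousLinearMap (selfAdjPart n)).contDiff
  have hk : ∀ i j, ContDiff ℝ ∞ fun L => (L - selfAdjPart n L) i j := fun i j =>
    (contDiff_entry i j).comp (contDiff_id.sub hs)
  refine (contDiffOn_pi.2 hb).prodMk (contDiffOn_pi.2 fun i => ?_)
  refine (contDiffOn_const.mul ?_).neg
  exact ContDiffOn.sum (s := Finset.univ) fun j _ => (hk i j).contDiffOn.mul (hb j)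

theorem isOpen_tensorPart_pos (n : ℕ) (r : ℝ) : IsOpen {L : Mat n | 0 < tensorPart n r L 0 0} :=
  isOpen_lt continuous_const ((contDiff_entry 0 0).comp (contDiff_tensorPart n r)).continuous

theorem orbit_subset_tensorPart_pos {n : ℕ} (hn : 1 ≤ n) {x₀ : Vec n} (hx₀ : 0 < lor n x₀ x₀) :
    orbit (rankOne x₀) ⊆ {L | 0 < tensorPart n (lor n x₀ x₀) L 0 0} := by
  rw [← (bijOn_orbitMap hn hx₀).image_eq]
  rintro _ ⟨q, hq, rfl⟩
  rw [mem_ofPred_eq, tensorPart_orbitMap hq.1.1, dyad_self_apply_zero]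
  exact mul_pos hq.2 hq.2

theorem isSymplectomorphism_orbitMap {n : ℕ} (hn : 1 ≤ n) {x₀ : Vec n} (hx₀ : 0 < lor n x₀ x₀) :
    IsSymplectomorphism
      (hyperboloidBundle n (lor n x₀ x₀)) bundleTangent canonicalForm
      (orbit (rankOne x₀)) orbitTangent (fun L V₁ V₂ => orbitForm L V₂ V₁) orbitMap where
  bijOn := bijOn_orbitMap hn hx₀
  smooth := ⟨univ, isOpen_univ, subset_univ _, contDiff_orbitMap.contDiffOn⟩
  smooth_inv := ⟨_, orbitInv n (lor n x₀ x₀), isOpen_tensorPart_pos n _,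
    orbit_subset_tensorPart_pos hn hx₀, contDiffOn_orbitInv n _,
    fun _ hq => orbitInv_orbitMap hx₀.ne' hq⟩
  bijOn_tangent _ hq := bijOn_fderiv_orbitMap (hq.1.1.trans_ne hx₀.ne')
  form_eq _ hq _ hv _ hw := orbitForm_fderiv_orbitMap (hq.1.1.trans_ne hx₀.ne') hv hw

/-! ### The opposite sign convention. -/

/-- The fibrewise reflection `(x, y) ↦ (x, -y)`. -/
noncomputable def fibreNeg (n : ℕ) : (Vec n × Vec n) ≃L[ℝ] (Vec n × Vec n) :=
  (ContinuousLinearEquiv.refl ℝ (Vec n)).prodCongr (ContinuousLinearEquiv.neg ℝ)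

theorem fibreNeg_apply {n : ℕ} (q : Vec n × Vec n) : fibreNeg n q = (q.1, -q.2) := rfl

theorem fibreNeg_fibreNeg {n : ℕ} (q : Vec n × Vec n) : fibreNeg n (fibreNeg n q) = q := by
  simp [fibreNeg_apply]

theorem fibreNeg_mem_hyperboloidBundle {n : ℕ} {r : ℝ} {q : Vec n × Vec n}
    (hq : q ∈ hyperboloidBundle n r) : fibreNeg n q ∈ hyperboloidBundle n r :=
  ⟨⟨hq.1.1, by rw [fibreNeg_apply, map_neg, hq.1.2, neg_zero]⟩, hq.2⟩

theorem fibreNeg_mem_bundleTangent {n : ℕ} {q v : Vec n × Vec n} (hv : v ∈ bundleTangent q) :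
    fibreNeg n v ∈ bundleTangent (fibreNeg n q) := by
  refine ⟨hv.1, ?_⟩
  have := hv.2
  simp only [fibreNeg_apply, map_neg]
  linarith

theorem bijOn_fibreNeg {n : ℕ} {s t : Set (Vec n × Vec n)} (hs : MapsTo (fibreNeg n) s t)
    (ht : MapsTo (fibreNeg n) t s) : BijOn (fibreNeg n) s t :=
  ⟨hs, (fibreNeg n).injective.injOn, fun q hq => ⟨_, ht hq, fibreNeg_fibreNeg q⟩⟩

theorem fderiv_orbitMap_comp_fibreNeg {n : ℕ} (q v : Vec n × Vec n) :
    fderiv ℝ (orbitMap ∘ fibreNeg n) q v = fderiv ℝ orbitMap (fibreNeg n q) (fibreNeg n v) := by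
  have h := DFunLike.congr_fun ((fibreNeg n).comp_right_fderiv (f := orbitMap) (x := q)) v
  exact h

theorem bijOn_fderiv_orbitMap_comp_fibreNeg {n : ℕ} {q : Vec n × Vec n} (hq : lor n q.1 q.1 ≠ 0) :
    BijOn (fderiv ℝ (orbitMap ∘ fibreNeg n) q) (bundleTangent q)
      (orbitTangent (orbitMap (fibreNeg n q))) := by
  refine ((bijOn_fderiv_orbitMap (q := fibreNeg n q) hq).comp (bijOn_fibreNeg
    (fun _ => fibreNeg_mem_bundleTangent) (fun v hv => ?_))).congr
    fun v _ => (fderiv_orbitMap_comp_fibreNeg q v).symm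
  have h := fibreNeg_mem_bundleTangent hv
  rwa [fibreNeg_fibreNeg] at h

/-- Fibre negation changes the sign of the canonical form, which compensates for exchanging the two
arguments. -/
theorem orbitForm_fderiv_orbitMap_comp_fibreNeg {n : ℕ} {q v w : Vec n × Vec n}
    (hq : lor n q.1 q.1 ≠ 0) (hv : v ∈ bundleTangent q) (hw : w ∈ bundleTangent q) :
    orbitForm (orbitMap (fibreNeg n q)) (fderiv ℝ (orbitMap ∘ fibreNeg n) q v)
      (fderiv ℝ (orbitMap ∘ fibreNeg n) q w) = canonicalForm q v w := by
  rw [fderiv_orbitMap_comp_fibreNeg, fderiv_orbitMap_comp_fibreNeg,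
    orbitForm_fderiv_orbitMap (q := fibreNeg n q) hq
      (fibreNeg_mem_bundleTangent hw) (fibreNeg_mem_bundleTangent hv),
    canonicalForm_eq, canonicalForm_eq]
  simp only [fibreNeg_apply, map_neg]
  ring

theorem isSymplectomorphism_orbitMap_fibreNeg {n : ℕ} (hn : 1 ≤ n) {x₀ : Vec n}
    (hx₀ : 0 < lor n x₀ x₀) :
    IsSymplectomorphism
      (hyperboloidBundle n (lor n x₀ x₀)) bundleTangent canonicalForm
      (orbit (rankOne x₀)) orbitTangent orbitForm (orbitMap ∘ fibreNeg n) where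
  bijOn := (bijOn_orbitMap hn hx₀).comp (bijOn_fibreNeg
    (fun _ => fibreNeg_mem_hyperboloidBundle) (fun _ => fibreNeg_mem_hyperboloidBundle))
  smooth := ⟨univ, isOpen_univ, subset_univ _,
    (contDiff_orbitMap.comp (fibreNeg n).contDiff).contDiffOn⟩
  smooth_inv := ⟨_, fibreNeg n ∘ orbitInv n (lor n x₀ x₀), isOpen_tensorPart_pos n _,
    orbit_subset_tensorPart_pos hn hx₀,
    (fibreNeg n).contDiff.comp_contDiffOn (contDiffOn_orbitInv n _),
    fun q hq => by
      rw [Function.comp_apply, Function.comp_apply,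
        orbitInv_orbitMap hx₀.ne' (fibreNeg_mem_hyperboloidBundle hq), fibreNeg_fibreNeg]⟩
  bijOn_tangent _ hq := bijOn_fderiv_orbitMap_comp_fibreNeg (hq.1.1.trans_ne hx₀.ne')
  form_eq _ hq _ hv _ hw :=
    orbitForm_fderiv_orbitMap_comp_fibreNeg (hq.1.1.trans_ne hx₀.ne') hv hw

end HyperbolicOrbit

theorem mainTheorem7 (n : ℕ) (hn : 1 ≤ n) (x₀ : Vec n) (hx₀ : lor n x₀ x₀ ≠ 0) :
    -- the coadjoint orbit
    orbit (rankOne x₀) =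
      {L | ∃ x y : Vec n, lor n x x = lor n x₀ x₀ ∧
        L = tensor x - (lor n x₀ x₀ / ((n : ℝ) + 1)) • (1 : Mat n) + wedge x y} ∧
    -- `(x, y) ↦ (y, ·)₋₁` identifies the bundle with the cotangent bundle of the quadric
    (∀ x : Vec n, lor n x x = lor n x₀ x₀ →
      BijOn (covector x) {y | lor n x y = 0} univ) ∧
    -- the canonical form of the cotangent bundle
    (∀ q v w : Vec n × Vec n, canonicalForm q v w = lor n v.1 w.2 - lor n w.1 v.2) ∧
    -- the bundle of the whole quadric covers the orbit, with fibres `{(x,y), (-x,-y)}`, and the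
    -- covering map carries the form of the orbit to the canonical form
    (orbitMap '' quadricBundle n (lor n x₀ x₀) = orbit (rankOne x₀) ∧
      (∀ q ∈ quadricBundle n (lor n x₀ x₀), ∀ q' ∈ quadricBundle n (lor n x₀ x₀),
        orbitMap q = orbitMap q' ↔ q' = q ∨ q' = -q) ∧
      ∀ q ∈ quadricBundle n (lor n x₀ x₀),
        BijOn (fderiv ℝ orbitMap q) (bundleTangent q) (orbitTangent (orbitMap q)) ∧
        ∀ v ∈ bundleTangent q, ∀ w ∈ bundleTangent q,
          orbitForm (orbitMap q) (fderiv ℝ orbitMap q w) (fderiv ℝ orbitMap q v) =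
            canonicalForm q v w) ∧
    -- the orbit is symplectomorphic to the cotangent bundle of the hyperboloid, for either sign
    -- convention for the form of the orbit
    (0 < lor n x₀ x₀ →
      IsSymplectomorphism
        (hyperboloidBundle n (lor n x₀ x₀)) bundleTangent canonicalForm
        (orbit (rankOne x₀)) orbitTangent (fun L V₁ V₂ => orbitForm L V₂ V₁)
        orbitMap ∧
      IsSymplectomorphism
        (hyperboloidBundle n (lor n x₀ x₀)) bundleTangent canonicalForm
        (orbit (rankOne x₀)) orbitTangent orbitForm
        (fun q => orbitMap (q.1, -q.2))) := by
  refine ⟨orbit_rankOne hn hx₀, fun x hx => bijOn_covector (hx.trans_ne hx₀), canonicalForm_eq,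
    ⟨image_orbitMap hn hx₀, fun q hq q' hq' => orbitMap_eq_iff hx₀ hq hq', fun q hq => ?_⟩,
    -- The map `orbitMap ∘ fibreNeg n` agrees with the stated one by unfolding.
    fun h => ⟨isSymplectomorphism_orbitMap hn h, isSymplectomorphism_orbitMap_fibreNeg hn h⟩⟩
  have hr : lor n q.1 q.1 ≠ 0 := hq.1.trans_ne hx₀
  exact ⟨bijOn_fderiv_orbitMap hr,
    fun v hv w hw => orbitForm_fderiv_orbitMap hr hv hw⟩
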